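/- Let $S\subseteq\mathbb N^m$ be a nonzero affine semigroup (a finitely generated submonoid) with minimal system of generators $A$. Write $\mathrm G(S)\subseteq\mathbb Z^m$ for the group spanned by $S$, $\operatorname{cone}(S)=\{q\mathbf a\mid q\in\mathbb Q_{\ge 0},\ \mathbf a\in S\}$, and $\operatorname{relint}(\operatorname{cone}(S))=\{\sum_{\mathbf a\in A}q_{\mathbf a}\mathbf a\mid q_{\mathbf a}\in\mathbb Q_{>0}\}$. A vector $\mathbf f\in \mathrm G(S)\setminus S$ is a *Frobenius vector* of $S$ if $\mathbf f+(\operatorname{relint}(\operatorname{cone}(S))\cap \mathrm G(S))\subseteq S$. For disjoint nonempty sets $A_1,A_2$, the monoid $\langle A_1\cup A_2\rangle$ is the *gluing* $S_1+_{\mathbf d}S_2$ of $S_1=\langle A_1\rangle$ and $S_2=\langle A_2\rangle$ by $\mathbf d$ if $\mathbf d\in S_1\cap S_2$ and $\mathrm G(S_1)\cap \mathrm G(S_2)=\mathbf d\,\mathbb Z$. Assume that $S$ is a *complete intersection*: a minimal presentation of $S$ (a minimal generating system of the kernel congruence of the homomorphism $\mathbb N^{A}\to S$, $\mathbf e_{\mathbf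 a}\mapsto\mathbf a$) has cardinality $|A|-\dim_{\mathbb Q}(\mathbb Q S)$. Then there are a partition $A=A_1\cup\dots\cup A_t$ into nonempty linearly independent sets and vectors $\mathbf d_1,\dots,\mathbf d_{t-1}$ such that $S$ is obtained by iterated gluing (with some bracketing) $$S=\langle A_1\rangle+_{\mathbf d_1}\langle A_2\rangle+_{\mathbf d_2}\cdots+_{\mathbf d_{t-1}}\langle A_t\rangle .$$ For every such decomposition, the vector $$\mathbf f=\sum_{i=1}^{t-1}\mathbf d_i-\sum_{\mathbf a\in A}\mathbf a$$ is a Frobenius vector of $S$, and every Frobenius vector $\mathbf f'$ of $S$ satisfies $\mathbf f'\in\mathbf f+\operatorname{cone}(S)$. -/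

import Mathlib

namespace AffineSemigroup

/-- An integer vector, seen in `ℚ^m`. -/
def toRat {m : ℕ} (x : Fin m → ℤ) : Fin m → ℚ := fun i => (x i : ℚ)

/-- An affine semigroup: a finitely generated submonoid of `ℤ^m` contained in `ℕ^m`. -/
def IsAffineSemigroup {m : ℕ} (S : AddSubmonoid (Fin m → ℤ)) : Prop :=
  S.FG ∧ ∀ s ∈ S, 0 ≤ s

/-- `A` is a minimal system of generators of the monoid `S`. -/
def IsMinimalGenerating {m : ℕ} (S : AddSubmonoid (Fin m → ℤ)) (A : Finset (Fin m → ℤ)) : Prop :=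
  Minimal (fun B : Set (Fin m → ℤ) => AddSubmonoid.closure B = S) (A : Set (Fin m → ℤ))

/-- The group `G(S)` spanned by `S`. -/
def groupSpan {m : ℕ} (S : AddSubmonoid (Fin m → ℤ)) : AddSubgroup (Fin m → ℤ) :=
  AddSubgroup.closure (S : Set (Fin m → ℤ))

/-- `cone(S) = { q a ∣ q ∈ ℚ, q ≥ 0, a ∈ S }`, a subset of `ℚ^m`. -/
def cone {m : ℕ} (S : AddSubmonoid (Fin m → ℤ)) : Set (Fin m → ℚ) :=
  {x | ∃ q : ℚ, 0 ≤ q ∧ ∃ a ∈ S, x = q • toRat a}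

/-- The relative interior of `cone(S)`: the combinations, with all coefficients positive
rationals, of the minimal generators of `S`. -/
def relInteriorCone {m : ℕ} (S : AddSubmonoid (Fin m → ℤ)) : Set (Fin m → ℚ) :=
  {x | ∃ A : Finset (Fin m → ℤ), IsMinimalGenerating S A ∧
    ∃ q : (Fin m → ℤ) → ℚ, (∀ a ∈ A, 0 < q a) ∧ x = ∑ a ∈ A, q a • toRat a}

/-- `f` is a Frobenius vector of `S`: it lies in `G(S) \ S` and
`f + (relint(cone S) ∩ G(S)) ⊆ S`. -/
def IsFrobeniusVector {m : ℕ} (S : AddSubmonoid (Fin m → ℤ)) (f : Fin m → ℤ) : Prop :=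
  f ∈ groupSpan S ∧ f ∉ S ∧
    ∀ g ∈ groupSpan S, toRat g ∈ relInteriorCone S → f + g ∈ S

/-- The homomorphism `φ : ℕ^A → ℤ^m` which maps the basis vector `e_a` to `a`. -/
def factorizationHom {m : ℕ} (A : Finset (Fin m → ℤ)) : (A → ℕ) →+ (Fin m → ℤ) where
  toFun u := ∑ a : A, u a • (a : Fin m → ℤ)
  map_zero' := by simp
  map_add' u v := by simp [add_smul, Finset.sum_add_distrib]

/-- `ρ` is a presentation of the monoid generated by `A`: it generates, as a congruence, the
kernel congruence of `φ`. -/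
def IsPresentation {m : ℕ} (A : Finset (Fin m → ℤ)) (ρ : Set ((A → ℕ) × (A → ℕ))) : Prop :=
  addConGen (fun u v => (u, v) ∈ ρ) = AddCon.ker (factorizationHom A)

/-- A minimal presentation: no proper subset is a presentation. -/
def IsMinimalPresentation {m : ℕ} (A : Finset (Fin m → ℤ)) (ρ : Set ((A → ℕ) × (A → ℕ))) :
    Prop :=
  Minimal (IsPresentation A) ρ

/-- The dimension of the `ℚ`-vector space spanned by `S`. -/
noncomputable def dimension {m : ℕ} (S : AddSubmonoid (Fin m → ℤ)) : ℕ :=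
  Module.finrank ℚ (Submodule.span ℚ (toRat '' (S : Set (Fin m → ℤ))))

/-- A complete intersection affine semigroup: the cardinality of a minimal presentation is the
embedding dimension (the number of minimal generators) minus the dimension of the vector space
spanned by `S`. (The minimal system of generators is unique, and all minimal presentations have
the same cardinality, so it is enough to speak of one.) -/
def IsCompleteIntersection {m : ℕ} (S : AddSubmonoid (Fin m → ℤ)) : Prop :=
  IsAffineSemigroup S ∧
    ∃ A : Finset (Fin m → ℤ), IsMinimalGenerating S A ∧
      ∃ ρ : Set ((A → ℕ) × (A → ℕ)), IsMinimalPresentation A ρ ∧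
        ρ.encard + (dimension S : ℕ∞) = (A.card : ℕ∞)

/-- For `S₁ = ⟨A₁⟩` and `S₂ = ⟨A₂⟩`, where `A₁`, `A₂` are disjoint and nonempty, the monoid
`⟨A₁ ∪ A₂⟩` is the gluing `S₁ +_d S₂`: `d ∈ S₁ ∩ S₂` and `G(S₁) ∩ G(S₂) = ℤ d`. -/
def IsGluing {m : ℕ} (A₁ A₂ : Finset (Fin m → ℤ)) (d : Fin m → ℤ) : Prop :=
  A₁.Nonempty ∧ A₂.Nonempty ∧ Disjoint A₁ A₂ ∧
    d ∈ AddSubmonoid.closure (A₁ : Set (Fin m → ℤ)) ∧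
    d ∈ AddSubmonoid.closure (A₂ : Set (Fin m → ℤ)) ∧
    groupSpan (AddSubmonoid.closure (A₁ : Set (Fin m → ℤ))) ⊓
      groupSpan (AddSubmonoid.closure (A₂ : Set (Fin m → ℤ))) = AddSubgroup.zmultiples d

/-- `IsIteratedGluing A D`: by successive gluings, in some bracketing, the monoid `⟨A⟩` is
`⟨A_1⟩ +_{d_1} ⟨A_2⟩ +_{d_2} ⋯ +_{d_{t-1}} ⟨A_t⟩`, where `A_1, …, A_t` is a partition of `A` into
nonempty linearly independent sets and `D` is the multiset `{d_1, …, d_{t-1}}`. -/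
inductive IsIteratedGluing {m : ℕ} : Finset (Fin m → ℤ) → Multiset (Fin m → ℤ) → Prop
  | free (A : Finset (Fin m → ℤ)) (hne : A.Nonempty)
      (hA : LinearIndepOn ℚ toRat (A : Set (Fin m → ℤ))) : IsIteratedGluing A 0
  | glue (A₁ A₂ : Finset (Fin m → ℤ)) (D₁ D₂ : Multiset (Fin m → ℤ)) (d : Fin m → ℤ)
      (h₁ : IsIteratedGluing A₁ D₁) (h₂ : IsIteratedGluing A₂ D₂) (hd : IsGluing A₁ A₂ d) :
      IsIteratedGluing (A₁ ∪ A₂) (d ::ₘ (D₁ + D₂))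

/-- The vector `∑ d_i - ∑_{a ∈ A} a`. -/
def gluingVector {m : ℕ} (A : Finset (Fin m → ℤ)) (D : Multiset (Fin m → ℤ)) : Fin m → ℤ :=
  D.sum - ∑ a ∈ A, a

end AffineSemigroup

/-!
The existence part rests on two facts.

*Sparsity.* Let the pairs `(u, v)` of a presentation be the rows of a family, the supports of `u`
and `v` being the two ends of a row. If the semigroup is a complete intersection, then for every
nonempty set `J` of generators fewer than `|J|` rows meet `J` with both ends
(`IsPresentation.isSparse`). Otherwise `J` may be enlarged until every row meets `J` with both ends
or with none. Then "both elements meet `J`, or both miss `J` and differ by a combination of the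
rows missing `J`" is a congruence containing the presentation, hence the kernel congruence. So the
relations between the generators outside of `J` are spanned by the rows missing `J`. By counting
dimensions these generators span the whole vector space, and a multiple of a generator in `J` is
then congruent to an element that misses `J`, which is absurd.

*Bridges.* A nonempty sparse family has a row whose two ends are separated by a set that no other
row crosses (`IsSparse.exists_bridge`). This is a form of Kotzig's theorem that a graph with a
unique perfect matching has a bridge in the matching, and it is proved by shrinking a blossom found
at the end of a longest alternating path. Cutting the generators at such a row exhibits the
semigroup as a gluing, and both parts inherit the sparse family (`exists_isIteratedGluing`).

For the Frobenius vector `f = ∑ d_i - ∑ a`, two statements are proved by induction along the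
gluings: `f + g` lies in the semigroup for `g` in the group and in the relative interior of the cone
(`IsIteratedGluing.gluingVector_add_mem`), and conversely an element `w` of the semigroup with
`f + w` in the semigroup lies in the relative interior (`IsIteratedGluing.mem_posCombos`). The case
`w = 0` of the latter shows that `f` is not in the semigroup. If `f'` is another Frobenius vector
and `f' - f` is not in the cone, a ray in the direction `f' - f` leaves the cone at a boundary
point, and a multiple `w` of this point contradicts the converse statement
(`IsIteratedGluing.sub_mem_nonnegCombos`). That the ray has a last rational point in
the cone follows from Fourier–Motzkin elimination.
-/

namespace AffineSemigroup

/-! ### Bridges of sparse families -/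

/-- A family of rows, the row `i` having two ends `E i true` and `E i false`, is sparse if for
every nonempty set `J` fewer than `|J|` rows have both ends meeting `J`. -/
def IsSparse {ι α : Type*} (R : Finset ι) (E : ι → Bool → Finset α) : Prop :=
  ∀ J : Finset α, J.Nonempty → ∀ T ⊆ R, (∀ i ∈ T, ∀ c, ∃ v ∈ J, v ∈ E i c) → T.card < J.card

lemma IsSparse.mono {ι α : Type*} {R R' : Finset ι} {E : ι → Bool → Finset α}
    (h : IsSparse R E) (hR : R' ⊆ R) : IsSparse R' E :=
  fun J hJ T hT hm => h J hJ T (hT.trans hR) hm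

/-- An alternating path: distinct rows `x 0, …, x k`, the row `x t` being left through its end
`b t`, which shares the element `y t` with the opposite end `!b (t + 1)` of the next row. -/
structure IsAlternatingPath {ι α : Type*} (R : Finset ι) (E : ι → Bool → Finset α) (k : ℕ)
    (x : ℕ → ι) (b : ℕ → Bool) (y : ℕ → α) : Prop where
  mem : ∀ t ≤ k, x t ∈ R
  inj : ∀ s ≤ k, ∀ t ≤ k, x s = x t → s = t
  out_mem : ∀ t < k, y t ∈ E (x t) (b t)
  in_mem : ∀ t < k, y t ∈ E (x (t + 1)) (!b (t + 1))

namespace IsAlternatingPath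

variable {ι α : Type*} {R : Finset ι} {E : ι → Bool → Finset α} {k : ℕ}
  {x : ℕ → ι} {b : ℕ → Bool} {y : ℕ → α}

lemma length_lt [DecidableEq ι] (h : IsAlternatingPath R E k x b y) : k < R.card := by
  have h1 : (Finset.image x (Finset.range (k + 1))).card = k + 1 := by
    rw [Finset.card_image_of_injOn, Finset.card_range]
    intro s hs t ht hst
    simp only [Finset.coe_range, Set.mem_Iio] at hs ht
    exact h.inj s (by omega) t (by omega) hst
  have h2 : Finset.image x (Finset.range (k + 1)) ⊆ R := by
    intro i hi
    simp only [Finset.mem_image, Finset.mem_range] at hi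
    obtain ⟨t, ht, rfl⟩ := hi
    exact h.mem t (by omega)
  have := Finset.card_le_card h2
  omega

lemma card_image_Icc [DecidableEq ι] (h : IsAlternatingPath R E k x b y) {s t : ℕ}
    (ht : t ≤ k) : (Finset.image x (Finset.Icc s t)).card = t + 1 - s := by
  rw [Finset.card_image_of_injOn, Nat.card_Icc]
  intro p hp q hq hpq
  simp only [Finset.coe_Icc, Set.mem_Icc] at hp hq
  exact h.inj p (by omega) q (by omega) hpq

/-- A set that contains the connecting elements of a segment of an alternating path and meets
both its initial end and its final end meets both ends of each of its rows. -/
lemma exists_mem_of_segment (h : IsAlternatingPath R E k x b y) {s t : ℕ} (ht : t ≤ k)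
    {J : Finset α} (hy : ∀ p, s ≤ p → p < t → y p ∈ J)
    (h0 : ∃ v ∈ J, v ∈ E (x s) (!b s)) (h1 : ∃ v ∈ J, v ∈ E (x t) (b t))
    {p : ℕ} (hsp : s ≤ p) (hpt : p ≤ t) (c : Bool) : ∃ v ∈ J, v ∈ E (x p) c := by
  have hout : ∃ v ∈ J, v ∈ E (x p) (b p) := by
    rcases hpt.eq_or_lt with rfl | hlt
    · exact h1
    · exact ⟨y p, hy p hsp hlt, h.out_mem p (by omega)⟩
  have hin : ∃ v ∈ J, v ∈ E (x p) (!b p) := by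
    rcases hsp.eq_or_lt with rfl | hlt
    · exact h0
    · obtain ⟨q, rfl⟩ : ∃ q, p = q + 1 := ⟨p - 1, by omega⟩
      exact ⟨y q, hy q (by omega) (by omega), h.in_mem q (by omega)⟩
  by_cases hc : c = b p
  · rw [hc]; exact hout
  · rw [Bool.eq_not.mpr hc]; exact hin

/-- An alternating path in a sparse family does not close up to an alternating cycle. -/
lemma disjoint_in_out [DecidableEq ι] [DecidableEq α] (h : IsAlternatingPath R E k x b y)
    (hE : IsSparse R E) {l : ℕ} (hl : l ≤ k) :
    Disjoint (E (x l) (!b l)) (E (x k) (b k)) := by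
  rw [Finset.disjoint_left]
  intro z hz1 hz2
  let J : Finset α := insert z (Finset.image y (Finset.Ico l k))
  have hJ : J.card ≤ k - l + 1 := by
    refine (Finset.card_insert_le _ _).trans ?_
    have := Finset.card_image_le (s := Finset.Ico l k) (f := y)
    rw [Nat.card_Ico] at this
    omega
  have key := hE J ⟨z, Finset.mem_insert_self _ _⟩ (Finset.image x (Finset.Icc l k)) ?_ ?_
  · rw [h.card_image_Icc le_rfl] at key
    omega
  · intro i hi
    simp only [Finset.mem_image, Finset.mem_Icc] at hi
    obtain ⟨t, ht, rfl⟩ := hi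
    exact h.mem t ht.2
  · intro i hi c
    simp only [Finset.mem_image, Finset.mem_Icc] at hi
    obtain ⟨t, ht, rfl⟩ := hi
    refine h.exists_mem_of_segment le_rfl (fun p hp hp' => ?_) ⟨z, ?_, hz1⟩ ⟨z, ?_, hz2⟩
      ht.1 ht.2 c
    · exact Finset.mem_insert_of_mem (Finset.mem_image_of_mem _ (Finset.mem_Ico.2 ⟨hp, hp'⟩))
    · exact Finset.mem_insert_self _ _
    · exact Finset.mem_insert_self _ _

/-- A row outside of the path that meets its final end prolongs it. -/
lemma exists_extension (h : IsAlternatingPath R E k x b y) {j : ι} (hj : j ∈ R)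
    (hjx : ∀ t ≤ k, x t ≠ j) {c : Bool} {v : α} (hv : v ∈ E j c) (hv' : v ∈ E (x k) (b k)) :
    ∃ x' b' y', IsAlternatingPath R E (k + 1) x' b' y' := by
  refine ⟨fun t => if t ≤ k then x t else j, fun t => if t ≤ k then b t else !c,
    fun t => if t < k then y t else v, ?_, ?_, ?_, ?_⟩
  · intro t _
    split_ifs with h1
    · exact h.mem t h1
    · exact hj
  · intro s hs t ht hst
    split_ifs at hst with h1 h2 h2
    · exact h.inj s h1 t h2 hst
    · exact absurd hst (hjx s h1)
    · exact absurd hst.symm (hjx t h2)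
    · omega
  · intro t ht
    have h1 : t ≤ k := by omega
    by_cases h2 : t < k
    · simpa [h1, h2] using h.out_mem t h2
    · obtain rfl : t = k := by omega
      simpa using hv'
  · intro t ht
    by_cases h2 : t < k
    · simpa [h2, Nat.succ_le_of_lt h2] using h.in_mem t h2
    · obtain rfl : t = k := by omega
      simpa using hv

end IsAlternatingPath

lemma exists_max_alternatingPath {ι α : Type*} [DecidableEq ι] [Nonempty α] {R : Finset ι}
    {E : ι → Bool → Finset α} (hR : R.Nonempty) :
    ∃ k x b y, IsAlternatingPath R E k x b y ∧
      ∀ x' b' y', ¬ IsAlternatingPath R E (k + 1) x' b' y' := by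
  classical
  obtain ⟨i, hi⟩ := hR
  let Q : ℕ → Prop := fun k => ∃ x b y, IsAlternatingPath R E k x b y
  have h0 : Q 0 := ⟨fun _ => i, fun _ => true, fun _ => Classical.arbitrary α,
    fun _ _ => hi, fun s hs t ht _ => by omega, fun t ht => by omega, fun t ht => by omega⟩
  have hspec : Q (Nat.findGreatest Q R.card) := Nat.findGreatest_spec (Nat.zero_le _) h0
  obtain ⟨x, b, y, h⟩ := hspec
  refine ⟨_, x, b, y, h, fun x' b' y' h' => ?_⟩
  exact Nat.findGreatest_is_greatest (P := Q) (n := R.card) (Nat.lt_succ_self _) h'.length_lt.le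
    ⟨x', b', y', h'⟩

/-- Shrinking a blossom preserves sparsity: when the final end of an alternating path meets the
end `b l` of the row `x l`, the rows `x (l + 1), …, x k` are dropped, and the end `b l` of the row
`x l` is enlarged by all their elements. From the row `x l`, every element of the blossom is
reached by an alternating path in one of the two directions around it. -/
lemma IsAlternatingPath.isSparse_shrink {ι α : Type*} [DecidableEq ι] [DecidableEq α]
    {R : Finset ι} {E : ι → Bool → Finset α} {k : ℕ} {x : ℕ → ι} {b : ℕ → Bool} {y : ℕ → α}
    (h : IsAlternatingPath R E k x b y) (hE : IsSparse R E) {l : ℕ}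
    {z : α} (hz1 : z ∈ E (x l) (b l)) (hz2 : z ∈ E (x k) (b k)) {U : Finset α}
    (hU : ∀ u ∈ U, u ∈ E (x l) (b l) ∨ ∃ t, l < t ∧ t ≤ k ∧ ∃ c, u ∈ E (x t) c) :
    IsSparse (R \ Finset.image x (Finset.Ioc l k))
      (fun j c => if j = x l ∧ c = b l then U else E j c) := by
  intro J hJ T hT hm
  by_contra! hcard
  have hTR : T ⊆ R := hT.trans Finset.sdiff_subset
  have hTx : ∀ t, l < t → t ≤ k → x t ∉ T := by
    intro t h1 h2 h3
    have := hT h3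
    simp only [Finset.mem_sdiff, Finset.mem_image, Finset.mem_Ioc, not_exists] at this
    exact this.2 t ⟨⟨h1, h2⟩, rfl⟩
  -- Only the row `x l` may have lost the property of meeting `J` with both ends.
  have hmE : ∀ j ∈ T, ∀ c, ¬ (j = x l ∧ c = b l) → ∃ v ∈ J, v ∈ E j c := by
    intro j hj c hjc
    simpa only [if_neg hjc] using hm j hj c
  have hnot : ¬ ∃ v ∈ J, v ∈ E (x l) (b l) := by
    intro hv
    refine absurd (hE J hJ T hTR fun j hj c => ?_) (by omega)
    by_cases hjc : j = x l ∧ c = b l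
    · rw [hjc.1, hjc.2]; exact hv
    · exact hmE j hj c hjc
  have hxT : x l ∈ T := by
    by_contra hxT
    refine absurd (hE J hJ T hTR fun j hj c => hmE j hj c ?_) (by omega)
    rintro ⟨rfl, -⟩
    exact hxT hj
  have hin : ∃ v ∈ J, v ∈ E (x l) (!b l) := hmE _ hxT _ (by simp)
  obtain ⟨u, huJ, huU⟩ : ∃ v ∈ J, v ∈ U := by simpa using hm _ hxT (b l)
  obtain hu | ⟨t, hlt, htk, c, huc⟩ := hU u huU
  · exact hnot ⟨u, huJ, hu⟩
  have herase : (T.erase (x l)).card + 1 = T.card := Finset.card_erase_add_one hxT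
  -- If `u` is in the exit end of `x t`, go forward from `x l` to `x t`; otherwise jump from `x l`
  -- to `x k` through `z` and go backward to `x t`.
  by_cases hc : c = b t
  · subst hc
    let K : Finset α := J ∪ Finset.image y (Finset.Ico l t)
    have hJK : ∀ v ∈ J, v ∈ K := fun v hv => Finset.mem_union_left _ hv
    have hK : K.card ≤ J.card + (t - l) := by
      refine (Finset.card_union_le _ _).trans ?_
      have := Finset.card_image_le (s := Finset.Ico l t) (f := y)
      rw [Nat.card_Ico] at this
      omega
    have hdisj : Disjoint (T.erase (x l)) (Finset.image x (Finset.Icc l t)) := by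
      rw [Finset.disjoint_right]
      intro j hj
      simp only [Finset.mem_image, Finset.mem_Icc] at hj
      obtain ⟨p, ⟨hp1, hp2⟩, rfl⟩ := hj
      rcases hp1.eq_or_lt with rfl | hp1
      · exact Finset.notMem_erase _ _
      · exact fun h' => hTx p hp1 (by omega) (Finset.mem_of_mem_erase h')
    have key := hE K (hJ.mono hJK) (T.erase (x l) ∪ Finset.image x (Finset.Icc l t)) ?_ ?_
    · rw [Finset.card_union_of_disjoint hdisj, h.card_image_Icc htk] at key
      omega
    · refine Finset.union_subset ((Finset.erase_subset _ _).trans hTR) fun j hj => ?_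
      simp only [Finset.mem_image, Finset.mem_Icc] at hj
      obtain ⟨p, ⟨hp1, hp2⟩, rfl⟩ := hj
      exact h.mem p (by omega)
    · intro j hj c'
      rcases Finset.mem_union.1 hj with hj | hj
      · obtain ⟨v, hv, hv'⟩ := hmE j (Finset.mem_of_mem_erase hj) c'
          (fun h' => Finset.ne_of_mem_erase hj h'.1)
        exact ⟨v, hJK v hv, hv'⟩
      · simp only [Finset.mem_image, Finset.mem_Icc] at hj
        obtain ⟨p, ⟨hp1, hp2⟩, rfl⟩ := hj
        obtain ⟨v, hv, hv'⟩ := hin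
        exact h.exists_mem_of_segment htk (fun q hq hq' => Finset.mem_union_right _
          (Finset.mem_image_of_mem _ (Finset.mem_Ico.2 ⟨hq, hq'⟩))) ⟨v, hJK v hv, hv'⟩
          ⟨u, hJK u huJ, huc⟩ hp1 hp2 c'
  · rw [Bool.eq_not.mpr hc] at huc
    let K : Finset α := J ∪ insert z (Finset.image y (Finset.Ico t k))
    have hJK : ∀ v ∈ J, v ∈ K := fun v hv => Finset.mem_union_left _ hv
    have hzK : z ∈ K := Finset.mem_union_right _ (Finset.mem_insert_self _ _)
    have hK : K.card ≤ J.card + (k - t + 1) := by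
      refine (Finset.card_union_le _ _).trans ?_
      have h1 := Finset.card_image_le (s := Finset.Ico t k) (f := y)
      have h2 := Finset.card_insert_le z (Finset.image y (Finset.Ico t k))
      rw [Nat.card_Ico] at h1
      omega
    have hdisj : Disjoint T (Finset.image x (Finset.Icc t k)) := by
      rw [Finset.disjoint_right]
      intro j hj
      simp only [Finset.mem_image, Finset.mem_Icc] at hj
      obtain ⟨p, ⟨hp1, hp2⟩, rfl⟩ := hj
      exact hTx p (by omega) hp2
    have key := hE K (hJ.mono hJK) (T ∪ Finset.image x (Finset.Icc t k)) ?_ ?_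
    · rw [Finset.card_union_of_disjoint hdisj, h.card_image_Icc le_rfl] at key
      omega
    · refine Finset.union_subset hTR fun j hj => ?_
      simp only [Finset.mem_image, Finset.mem_Icc] at hj
      obtain ⟨p, ⟨hp1, hp2⟩, rfl⟩ := hj
      exact h.mem p (by omega)
    · intro j hj c'
      rcases Finset.mem_union.1 hj with hj | hj
      · by_cases hjc : j = x l ∧ c' = b l
        · rw [hjc.1, hjc.2]; exact ⟨z, hzK, hz1⟩
        · obtain ⟨v, hv, hv'⟩ := hmE j hj c' hjc
          exact ⟨v, hJK v hv, hv'⟩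
      · simp only [Finset.mem_image, Finset.mem_Icc] at hj
        obtain ⟨p, ⟨hp1, hp2⟩, rfl⟩ := hj
        exact h.exists_mem_of_segment le_rfl (fun q hq hq' => Finset.mem_union_right _
          (Finset.mem_insert_of_mem (Finset.mem_image_of_mem _ (Finset.mem_Ico.2 ⟨hq, hq'⟩))))
          ⟨u, hJK u huJ, huc⟩ ⟨z, hzK, hz2⟩ hp1 hp2 c'

/-- A nonempty sparse family has a row that is a bridge: some set `B` contains one of its ends and
misses the other, and every other row lies inside or outside of `B`. This is Kotzig's theorem on
graphs with a unique perfect matching, for the graph on the ends of the rows in which the two ends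
of a row are matched and ends of different rows are adjacent when they intersect. -/
theorem IsSparse.exists_bridge {ι α : Type*} [DecidableEq ι] [DecidableEq α] {R : Finset ι}
    {E : ι → Bool → Finset α} (hE : IsSparse R E) (hR : R.Nonempty) :
    ∃ i ∈ R, ∃ b, ∃ B : Set α, (∀ v ∈ E i b, v ∈ B) ∧ (∀ v ∈ E i (!b), v ∉ B) ∧
      ∀ j ∈ R, j ≠ i → (∀ c, ∀ v ∈ E j c, v ∈ B) ∨ (∀ c, ∀ v ∈ E j c, v ∉ B) := by
  induction hn : R.card using Nat.strong_induction_on generalizing R E with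
  | _ n ih =>
  subst hn
  rcases isEmpty_or_nonempty α with hα | hα
  · obtain ⟨i, hi⟩ := hR
    exact ⟨i, hi, true, ∅, fun v => hα.elim v, fun v => hα.elim v,
      fun _ _ _ => Or.inl fun _ v => hα.elim v⟩
  obtain ⟨k, x, b, y, h, hmax⟩ := exists_max_alternatingPath (E := E) hR
  have hout : ∀ j ∈ R, (∀ t ≤ k, x t ≠ j) → ∀ c, ∀ v ∈ E j c, v ∉ E (x k) (b k) := by
    intro j hj hjx c v hv hv'
    obtain ⟨x', b', y', h'⟩ := h.exists_extension hj hjx hv hv'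
    exact hmax x' b' y' h'
  have hin : ∀ l ≤ k, ∀ v ∈ E (x l) (!b l), v ∉ E (x k) (b k) := fun l hl v hv =>
    Finset.disjoint_left.1 (h.disjoint_in_out hE hl) hv
  by_cases hQ : ∃ l < k, ∃ z ∈ E (x l) (b l), z ∈ E (x k) (b k)
  · obtain ⟨l, hl, z, hz1, hz2⟩ := hQ
    let U : Finset α := E (x l) (b l) ∪
      (Finset.Ioc l k).biUnion fun t => E (x t) true ∪ E (x t) false
    have hU : ∀ t, l < t → t ≤ k → ∀ c, ∀ u ∈ E (x t) c, u ∈ U := by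
      intro t h1 h2 c u hu
      refine Finset.mem_union_right _ (Finset.mem_biUnion.2 ⟨t, Finset.mem_Ioc.2 ⟨h1, h2⟩, ?_⟩)
      cases c
      · exact Finset.mem_union_right _ hu
      · exact Finset.mem_union_left _ hu
    have hU' : ∀ u ∈ U, u ∈ E (x l) (b l) ∨ ∃ t, l < t ∧ t ≤ k ∧ ∃ c, u ∈ E (x t) c := by
      intro u hu
      rcases Finset.mem_union.1 hu with hu | hu
      · exact Or.inl hu
      · obtain ⟨t, ht, hu⟩ := Finset.mem_biUnion.1 hu
        rw [Finset.mem_Ioc] at ht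
        refine Or.inr ⟨t, ht.1, ht.2, ?_⟩
        rcases Finset.mem_union.1 hu with hu | hu
        exacts [⟨_, hu⟩, ⟨_, hu⟩]
    have hsub : ∀ v ∈ E (x l) (b l), v ∈ U := fun v hv => Finset.mem_union_left _ hv
    have hxl : x l ∈ R \ Finset.image x (Finset.Ioc l k) := by
      rw [Finset.mem_sdiff]
      refine ⟨h.mem l hl.le, fun h' => ?_⟩
      simp only [Finset.mem_image, Finset.mem_Ioc] at h'
      obtain ⟨t, ⟨h1, h2⟩, h3⟩ := h'
      have := h.inj t h2 l hl.le h3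
      omega
    have hlt : (R \ Finset.image x (Finset.Ioc l k)).card < R.card := by
      refine Finset.card_lt_card (Finset.ssubset_iff_subset_ne.2 ⟨Finset.sdiff_subset, ?_⟩)
      intro h'
      have := h'.symm ▸ h.mem k le_rfl
      simp only [Finset.mem_sdiff, Finset.mem_image, Finset.mem_Ioc, not_exists] at this
      exact this.2 k ⟨⟨hl, le_rfl⟩, rfl⟩
    obtain ⟨i, hi, d, B, h1, h2, h3⟩ := ih _ hlt (h.isSparse_shrink hE hz1 hz2 hU') ⟨_, hxl⟩ rfl
    have hiR := (Finset.mem_sdiff.1 hi).1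
    -- All of `U` is on one side, so that the dropped rows are on that side, too.
    have hUB : (∀ u ∈ U, u ∈ B) ∨ (∀ u ∈ U, u ∉ B) := by
      by_cases hil : i = x l
      · by_cases hd : d = b l
        · exact Or.inl (by simpa [hil, hd] using h1)
        · right
          have hd' : (!d) = b l := by rw [Bool.eq_not.mpr hd, Bool.not_not]
          simpa [hil, hd'] using h2
      · rcases h3 (x l) hxl (Ne.symm hil) with h3 | h3
        · exact Or.inl (by simpa using h3 (b l))
        · exact Or.inr (by simpa using h3 (b l))
    have hE' : ∀ j c, ∀ v ∈ E j c, v ∈ (if j = x l ∧ c = b l then U else E j c) := by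
      intro j c v hv
      split_ifs with hjc
      · rw [hjc.1, hjc.2] at hv
        exact hsub v hv
      · exact hv
    refine ⟨i, hiR, d, B, fun v hv => h1 v (hE' _ _ v hv), fun v hv => h2 v (hE' _ _ v hv), ?_⟩
    intro j hj hji
    by_cases hjx : j ∈ Finset.image x (Finset.Ioc l k)
    · simp only [Finset.mem_image, Finset.mem_Ioc] at hjx
      obtain ⟨t, ⟨ht1, ht2⟩, rfl⟩ := hjx
      rcases hUB with hUB | hUB
      · exact Or.inl fun c v hv => hUB v (hU t ht1 ht2 c v hv)
      · exact Or.inr fun c v hv => hUB v (hU t ht1 ht2 c v hv)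
    · rcases h3 j (Finset.mem_sdiff.2 ⟨hj, hjx⟩) hji with h3 | h3
      · exact Or.inl fun c v hv => h3 c v (hE' _ _ v hv)
      · exact Or.inr fun c v hv => h3 c v (hE' _ _ v hv)
  -- If there is no blossom, the final end of the path meets no other row.
  · push Not at hQ
    refine ⟨x k, h.mem k le_rfl, b k, (E (x k) (b k) : Set α), fun v hv => hv,
      fun v hv => hin k le_rfl v hv, fun j hj hjk => Or.inr fun c v hv => ?_⟩
    by_cases hjx : ∀ t ≤ k, x t ≠ j
    · exact hout j hj hjx c v hv
    · push Not at hjx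
      obtain ⟨t, htk, rfl⟩ := hjx
      have htk' : t < k := lt_of_le_of_ne htk (fun h' => hjk (by rw [h']))
      by_cases hc : c = b t
      · subst hc; exact hQ t htk' v hv
      · rw [Bool.eq_not.mpr hc] at hv
        exact hin t htk v hv

/-! ### Lattices and presentations -/

lemma exists_nat_mul_eq_intCast_of_mem {β : Type*} (s : Finset β) (q : β → ℚ) :
    ∃ N : ℕ, 0 < N ∧ ∃ z : β → ℤ, ∀ b ∈ s, (N : ℚ) * q b = z b := by
  classical
  refine ⟨∏ b ∈ s, (q b).den, Finset.prod_pos fun b _ => (q b).den_pos,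
    fun b => (∏ b' ∈ s.erase b, ((q b').den : ℤ)) * (q b).num, fun b hb => ?_⟩
  rw [← Finset.mul_prod_erase s _ hb]
  have := Rat.mul_den_eq_num (q b)
  push_cast
  linear_combination (∏ b' ∈ s.erase b, ((q b').den : ℚ)) * this

lemma exists_nat_mul_eq_intCast {β : Type*} [Fintype β] (q : β → ℚ) :
    ∃ N : ℕ, 0 < N ∧ ∃ z : β → ℤ, ∀ b, (N : ℚ) * q b = z b := by
  simpa using exists_nat_mul_eq_intCast_of_mem Finset.univ q

variable {m : ℕ}

lemma toRat_add (x y : Fin m → ℤ) : toRat (x + y) = toRat x + toRat y := by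
  ext i; simp [toRat]

lemma toRat_zero : toRat (0 : Fin m → ℤ) = 0 := by
  ext i; simp [toRat]

lemma toRat_sub (x y : Fin m → ℤ) : toRat (x - y) = toRat x - toRat y := by
  ext i; simp [toRat]

lemma toRat_injective : Function.Injective (toRat : (Fin m → ℤ) → Fin m → ℚ) := by
  intro x y h
  ext i
  have := congrFun h i
  simpa [toRat] using this

lemma toRat_zsmul (k : ℤ) (x : Fin m → ℤ) : toRat (k • x) = (k : ℚ) • toRat x := by
  ext i; simp [toRat]

lemma toRat_nsmul (k : ℕ) (x : Fin m → ℤ) : toRat (k • x) = (k : ℚ) • toRat x := by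
  ext i; simp [toRat]

lemma toRat_sum {β : Type*} (s : Finset β) (f : β → Fin m → ℤ) :
    toRat (∑ b ∈ s, f b) = ∑ b ∈ s, toRat (f b) := by
  ext i; simp [toRat]

/-- The group homomorphism `ℤ^A → ℤ^m` which maps the basis vector `e_a` to `a`. -/
def latticeHom (A : Finset (Fin m → ℤ)) : (A → ℤ) →+ (Fin m → ℤ) where
  toFun z := ∑ a : A, z a • (a : Fin m → ℤ)
  map_zero' := by simp
  map_add' u v := by simp [add_smul, Finset.sum_add_distrib]

lemma latticeHom_apply (A : Finset (Fin m → ℤ)) (z : A → ℤ) :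
    latticeHom A z = ∑ a : A, z a • (a : Fin m → ℤ) := rfl

lemma factorizationHom_apply (A : Finset (Fin m → ℤ)) (u : A → ℕ) :
    factorizationHom A u = ∑ a : A, u a • (a : Fin m → ℤ) := rfl

lemma latticeHom_natCast (A : Finset (Fin m → ℤ)) (u : A → ℕ) :
    latticeHom A (fun a => (u a : ℤ)) = factorizationHom A u := by
  simp [latticeHom_apply, factorizationHom_apply]

lemma factorizationHom_toNat {A : Finset (Fin m → ℤ)} {z : A → ℤ} (hz : latticeHom A z = 0) :
    factorizationHom A (fun a => (z a).toNat) = factorizationHom A (fun a => (-z a).toNat) := by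
  rw [← latticeHom_natCast, ← latticeHom_natCast, ← sub_eq_zero, ← map_sub, ← hz]
  congr 1
  ext a
  simp only [Pi.sub_apply]
  omega

lemma eq_zero_of_factorizationHom_eq_zero {A : Finset (Fin m → ℤ)} (hA : ∀ a ∈ A, 0 < a)
    {u : A → ℕ} (h : factorizationHom A u = 0) : u = 0 := by
  rw [factorizationHom_apply, Finset.sum_eq_zero_iff_of_nonneg
    fun (a : A) _ => nsmul_nonneg (hA a a.2).le _] at h
  ext a
  have h1 := h a (Finset.mem_univ a)
  rcases smul_eq_zero.1 h1 with h1 | h1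
  · exact h1
  · exact absurd h1 (hA a a.2).ne'

/-- The difference `u - v ∈ ℤ^A` of a pair `(u, v)` of factorizations. -/
def pairDiff {α : Type*} (p : (α → ℕ) × (α → ℕ)) : α → ℤ := fun a => (p.1 a : ℤ) - p.2 a

/-- The two components of a pair, indexed by a Boolean. -/
def pairSide {α : Type*} (p : (α → ℕ) × (α → ℕ)) (c : Bool) : α → ℕ := if c then p.1 else p.2

/-- The supports of the two components of a pair. -/
def pairSupport {α : Type*} [Fintype α] (p : (α → ℕ) × (α → ℕ)) (c : Bool) : Finset α :=
  Finset.univ.filter fun a => pairSide p c a ≠ 0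

lemma mem_pairSupport {α : Type*} [Fintype α] {p : (α → ℕ) × (α → ℕ)} {c : Bool} {a : α} :
    a ∈ pairSupport p c ↔ pairSide p c a ≠ 0 := by
  simp [pairSupport]

/-- If both components of each pair of a presentation meet `J`, or both miss it, then the support
of an element congruent to one that misses `J` misses `J` too, and the difference is an integer
combination of the pairs that miss `J`. -/
lemma IsPresentation.of_factorizationHom_eq {A : Finset (Fin m → ℤ)}
    {ρ : Set ((A → ℕ) × (A → ℕ))} (hρ : IsPresentation A ρ) {J : Finset A}
    (hJ : ∀ p ∈ ρ, (∀ c, ∃ a ∈ J, a ∈ pairSupport p c) ∨ ∀ c, ∀ a ∈ J, a ∉ pairSupport p c)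
    {u v : A → ℕ} (huv : factorizationHom A u = factorizationHom A v)
    (hv : ∀ a ∈ J, v a = 0) :
    (∀ a ∈ J, u a = 0) ∧ pairDiff (u, v) ∈
      AddSubgroup.closure (pairDiff '' {p ∈ ρ | ∀ c, ∀ a ∈ J, a ∉ pairSupport p c}) := by
  set M := AddSubgroup.closure (pairDiff '' {p ∈ ρ | ∀ c, ∀ a ∈ J, a ∉ pairSupport p c})
  -- The congruence: both elements meet `J`, or both miss it and their difference lies in `M`.
  let c : AddCon (A → ℕ) :=
    { r := fun u v => ((∃ a ∈ J, u a ≠ 0) ∧ ∃ a ∈ J, v a ≠ 0) ∨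
        ((∀ a ∈ J, u a = 0) ∧ (∀ a ∈ J, v a = 0) ∧ pairDiff (u, v) ∈ M)
      iseqv := by
        refine ⟨fun u => ?_, fun {u v} h => ?_, fun {u v w} h1 h2 => ?_⟩
        · by_cases h : ∃ a ∈ J, u a ≠ 0
          · exact Or.inl ⟨h, h⟩
          · push Not at h
            refine Or.inr ⟨h, h, ?_⟩
            have : pairDiff (u, u) = 0 := by ext a; simp [pairDiff]
            rw [this]; exact M.zero_mem
        · rcases h with ⟨h1, h2⟩ | ⟨h1, h2, h3⟩
          · exact Or.inl ⟨h2, h1⟩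
          · refine Or.inr ⟨h2, h1, ?_⟩
            have : pairDiff (v, u) = -pairDiff (u, v) := by ext a; simp [pairDiff]
            rw [this]; exact M.neg_mem h3
        · rcases h1 with ⟨h1, a, ha, ha'⟩ | ⟨h1, h1', h1''⟩
          · rcases h2 with ⟨-, h2⟩ | ⟨h2, -, -⟩
            · exact Or.inl ⟨h1, h2⟩
            · exact absurd (h2 a ha) ha'
          · rcases h2 with ⟨⟨a, ha, ha'⟩, -⟩ | ⟨-, h2, h2'⟩
            · exact absurd (h1' a ha) ha'
            · refine Or.inr ⟨h1, h2, ?_⟩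
              have : pairDiff (u, w) = pairDiff (u, v) + pairDiff (v, w) := by
                ext a; simp [pairDiff]
              rw [this]; exact M.add_mem h1'' h2'
      add' := by
        intro u v w x h1 h2
        rcases h1 with ⟨⟨a, ha, ha'⟩, a', hb, hb'⟩ | ⟨h1, h1', h1''⟩
        · exact Or.inl ⟨⟨a, ha, by simp [ha']⟩, a', hb, by simp [hb']⟩
        · rcases h2 with ⟨⟨a, ha, ha'⟩, a', hb, hb'⟩ | ⟨h2, h2', h2''⟩
          · exact Or.inl ⟨⟨a, ha, by simp [ha']⟩, a', hb, by simp [hb']⟩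
          · refine Or.inr ⟨fun a ha => by simp [h1 a ha, h2 a ha],
              fun a ha => by simp [h1' a ha, h2' a ha], ?_⟩
            have : pairDiff (u + w, v + x) = pairDiff (u, v) + pairDiff (w, x) := by
              ext a
              simp only [pairDiff, Pi.add_apply]
              push_cast
              ring
            rw [this]; exact M.add_mem h1'' h2'' }
  have hle : AddCon.ker (factorizationHom A) ≤ c := by
    rw [← hρ, AddCon.addConGen_le]
    intro p q hpq
    rcases hJ _ hpq with h | h
    · left
      obtain ⟨a, ha, ha'⟩ := h true
      obtain ⟨b, hb, hb'⟩ := h false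
      exact ⟨⟨a, ha, by simpa [pairSide] using mem_pairSupport.1 ha'⟩,
        b, hb, by simpa [pairSide] using mem_pairSupport.1 hb'⟩
    · right
      refine ⟨fun a ha => ?_, fun a ha => ?_, AddSubgroup.subset_closure ⟨_, ⟨hpq, h⟩, rfl⟩⟩
      · simpa [mem_pairSupport, pairSide] using h true a ha
      · simpa [mem_pairSupport, pairSide] using h false a ha
  rcases hle (show AddCon.ker (factorizationHom A) u v from huv) with ⟨-, a, ha, ha'⟩ | ⟨h1, -, h2⟩
  · exact absurd (hv a ha) ha'
  · exact ⟨h1, h2⟩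

/-- For a complete intersection, a nonempty set `J` such that both components of each pair of the
presentation meet `J`, or both miss it, has more elements than there are pairs meeting it:
otherwise, for dimension reasons, the generators outside of `J` span the whole vector space, so
that a multiple of a generator in `J` lies in their group, although no relation links the two. -/
lemma IsPresentation.card_lt {A : Finset (Fin m → ℤ)}
    {R : Finset ((A → ℕ) × (A → ℕ))} (hρ : IsPresentation A (R : Set ((A → ℕ) × (A → ℕ))))
    (hdim : R.card + Module.finrank ℚ (Submodule.span ℚ (toRat '' (A : Set (Fin m → ℤ)))) =
      A.card)
    {J : Finset A} (hJne : J.Nonempty)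
    (hJ : ∀ p ∈ R, (∀ c, ∃ a ∈ J, a ∈ pairSupport p c) ∨ ∀ c, ∀ a ∈ J, a ∉ pairSupport p c)
    {T : Finset ((A → ℕ) × (A → ℕ))} (hTR : T ⊆ R)
    (hT : ∀ p ∈ T, ∀ c, ∃ a ∈ J, a ∈ pairSupport p c) : T.card < J.card := by
  classical
  by_contra! hTJ
  let D := R.filter fun p => ∀ c, ∀ a ∈ J, a ∉ pairSupport p c
  have hDset : (D : Set ((A → ℕ) × (A → ℕ))) =
      {p ∈ (R : Set ((A → ℕ) × (A → ℕ))) | ∀ c, ∀ a ∈ J, a ∉ pairSupport p c} := by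
    ext p; simp [D]
  have hDT : D.card + T.card ≤ R.card := by
    rw [← Finset.card_union_of_disjoint]
    · exact Finset.card_le_card (Finset.union_subset (Finset.filter_subset _ _) hTR)
    · rw [Finset.disjoint_left]
      intro p hp hp'
      obtain ⟨a, ha, ha'⟩ := hT p hp' true
      exact (Finset.mem_filter.1 hp).2 true a ha ha'
  let g : ({a : A // a ∉ J} → ℚ) →ₗ[ℚ] (Fin m → ℚ) :=
    Fintype.linearCombination ℚ (fun a : {a : A // a ∉ J} => toRat (a : Fin m → ℤ))
  have hg : ∀ q, g q = ∑ a, q a • toRat (a : Fin m → ℤ) := fun q => rfl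
  let res : (A → ℤ) → ({a : A // a ∉ J} → ℚ) := fun z a => (z a : ℚ)
  -- The relations between the generators outside of `J` are spanned by the pairs in `D`.
  have hker : LinearMap.ker g ≤
      Submodule.span ℚ ((D.image fun p => res (pairDiff p) : Finset _) : Set _) := by
    intro q hq
    obtain ⟨N, hN, z, hz⟩ := exists_nat_mul_eq_intCast q
    let z' : A → ℤ := fun a => if h : a ∈ J then 0 else z ⟨a, h⟩
    have hz'0 : ∀ a ∈ J, z' a = 0 := fun a ha => by simp [z', ha]
    have hres : res z' = (N : ℚ) • q := by
      ext a
      simp [res, z', a.2, hz]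
    have hlat : latticeHom A z' = 0 := by
      apply toRat_injective
      rw [latticeHom_apply, toRat_sum, toRat_zero]
      have h1 : ∑ a : A, toRat (z' a • (a : Fin m → ℤ)) =
          ∑ a : {a : A // a ∉ J}, toRat (z' a • ((a : A) : Fin m → ℤ)) := by
        rw [← Fintype.sum_subtype_add_sum_subtype (fun a => a ∈ J), Finset.sum_eq_zero, zero_add]
        intro a _
        rw [hz'0 a a.2, zero_smul, toRat_zero]
      rw [h1]
      have h2 : g ((N : ℚ) • q) = 0 := by rw [map_smul, LinearMap.mem_ker.1 hq, smul_zero]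
      rw [← hres, hg] at h2
      rw [← h2]
      exact Finset.sum_congr rfl fun a _ => toRat_zsmul _ _
    have hmem := (hρ.of_factorizationHom_eq (J := J) hJ (factorizationHom_toNat hlat)
      fun a ha => by simp [hz'0 a ha]).2
    have hdiff : pairDiff (fun a => (z' a).toNat, fun a => (-z' a).toNat) = z' := by
      ext a
      simp only [pairDiff]
      omega
    rw [hdiff, ← hDset] at hmem
    have hspan : ∀ x ∈ AddSubgroup.closure (pairDiff '' (D : Set ((A → ℕ) × (A → ℕ)))),
        res x ∈ Submodule.span ℚ
          ((D.image fun p => res (pairDiff p) : Finset _) : Set ({a : A // a ∉ J} → ℚ)) := by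
      intro x hx
      induction hx using AddSubgroup.closure_induction with
      | mem x hx =>
        obtain ⟨p, hp, rfl⟩ := hx
        exact Submodule.subset_span (Finset.mem_coe.2 (Finset.mem_image_of_mem _ hp))
      | zero =>
        have : res 0 = 0 := by ext a; simp [res]
        rw [this]; exact Submodule.zero_mem _
      | add x y _ _ hx hy =>
        have : res (x + y) = res x + res y := by ext a; simp [res]
        rw [this]; exact Submodule.add_mem _ hx hy
      | neg x _ hx =>
        have : res (-x) = -res x := by ext a; simp [res]
        rw [this]; exact Submodule.neg_mem _ hx
    have h3 := hspan _ hmem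
    rw [hres] at h3
    exact (Submodule.smul_mem_iff _ (by positivity)).1 h3
  have hkerdim : Module.finrank ℚ (LinearMap.ker g) ≤ D.card :=
    (Submodule.finrank_mono hker).trans
      ((finrank_span_finset_le_card _).trans Finset.card_image_le)
  have hrk := LinearMap.finrank_range_add_finrank_ker g
  have hcardJ : Fintype.card {a : A // a ∉ J} = A.card - J.card := by
    rw [Fintype.card_subtype_compl]
    simp
  rw [Module.finrank_fintype_fun_eq_card, hcardJ] at hrk
  have hJA : J.card ≤ A.card := by simpa using Finset.card_le_univ J
  have hrange : LinearMap.range g ≤ Submodule.span ℚ (toRat '' (A : Set (Fin m → ℤ))) := by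
    rintro _ ⟨q, rfl⟩
    rw [hg]
    exact Submodule.sum_mem _ fun a _ => Submodule.smul_mem _ _
      (Submodule.subset_span ⟨a, a.1.2, rfl⟩)
  -- By the count of dimensions, the generators outside of `J` span the same space as `A`.
  have heq := Submodule.eq_of_le_of_finrank_le hrange (by omega)
  obtain ⟨a, haJ⟩ := hJne
  have ha : toRat (a : Fin m → ℤ) ∈ LinearMap.range g := by
    rw [heq]
    exact Submodule.subset_span ⟨a, a.2, rfl⟩
  obtain ⟨q, hq⟩ := ha
  obtain ⟨N, hN, z, hz⟩ := exists_nat_mul_eq_intCast q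
  -- The relation saying that `N • a` is an integer combination of the generators outside of `J`.
  let z' : A → ℤ := fun b => if h : b ∈ J then (if b = a then N else 0) else -z ⟨b, h⟩
  have hlat : latticeHom A z' = 0 := by
    apply toRat_injective
    rw [latticeHom_apply, toRat_sum, toRat_zero,
      ← Fintype.sum_subtype_add_sum_subtype (fun a => a ∈ J),
      Finset.sum_eq_single (⟨a, haJ⟩ : {a : A // a ∈ J})]
    · have h1 : ∑ b : {b : A // b ∉ J}, toRat (z' b • ((b : A) : Fin m → ℤ)) =
          -((N : ℚ) • g q) := by
        rw [hg, Finset.smul_sum, ← Finset.sum_neg_distrib]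
        refine Finset.sum_congr rfl fun b _ => ?_
        rw [toRat_zsmul, smul_smul, hz, ← neg_smul]
        simp [z', b.2]
      rw [h1, hq, toRat_zsmul]
      simp [z', haJ]
    · intro b _ hb
      have hb' : (b : A) ≠ a := fun h => hb (Subtype.ext h)
      simp [z', b.2, hb', toRat_zero]
    · simp
  have hmem := (hρ.of_factorizationHom_eq (J := J) hJ (factorizationHom_toNat hlat)
    fun b hb => by
      simp only [z', hb, dite_true]
      split_ifs <;> simp).1 a haJ
  simp [z', haJ] at hmem
  omega

/-- The supports of the pairs of a presentation of a complete intersection form a sparse family.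
A set violating this can be enlarged, pair by pair, until each pair meets it with both of its
components or with none. -/
theorem IsPresentation.isSparse {A : Finset (Fin m → ℤ)} (hA : ∀ a ∈ A, 0 < a)
    {R : Finset ((A → ℕ) × (A → ℕ))} (hρ : IsPresentation A (R : Set ((A → ℕ) × (A → ℕ))))
    (hφ : ∀ p ∈ R, factorizationHom A p.1 = factorizationHom A p.2)
    (hdim : R.card + Module.finrank ℚ (Submodule.span ℚ (toRat '' (A : Set (Fin m → ℤ)))) =
      A.card) : IsSparse R pairSupport := by
  classical
  intro J hJne T hTR hT
  induction hn : Jᶜ.card using Nat.strong_induction_on generalizing J T with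
  | _ n ih =>
  subst hn
  by_cases hJ : ∀ p ∈ R, (∀ c, ∃ a ∈ J, a ∈ pairSupport p c) ∨
      ∀ c, ∀ a ∈ J, a ∉ pairSupport p c
  · exact hρ.card_lt hdim hJne hJ hTR hT
  push Not at hJ
  obtain ⟨p, hp, ⟨c, hc⟩, c', hc'⟩ := hJ
  obtain rfl : c' = !c := by
    rw [Bool.eq_not]
    rintro rfl
    obtain ⟨a, ha, ha'⟩ := hc'
    exact hc a ha ha'
  obtain ⟨a, ha⟩ : ∃ a, a ∈ pairSupport p c := by
    by_contra! h
    have h0 : pairSide p c = 0 := by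
      ext a
      simpa [mem_pairSupport] using h a
    have h1 : factorizationHom A (pairSide p (!c)) = factorizationHom A (pairSide p c) := by
      cases c
      · simpa [pairSide] using hφ p hp
      · simpa [pairSide] using (hφ p hp).symm
    rw [h0, map_zero] at h1
    obtain ⟨b, hb, hb'⟩ := hc'
    exact mem_pairSupport.1 hb' (congrFun (eq_zero_of_factorizationHom_eq_zero hA h1) b)
  have haJ : a ∉ J := fun h => hc a h ha
  have hpT : p ∉ T := by
    intro h
    obtain ⟨b, hb, hb'⟩ := hT p h c
    exact hc b hb hb'
  have hlt : (insert a J)ᶜ.card < Jᶜ.card := by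
    refine Finset.card_lt_card ⟨fun x => by simp, fun h => ?_⟩
    have := h (Finset.mem_compl.2 haJ)
    simp at this
  have key := ih _ hlt (J := insert a J) ⟨a, Finset.mem_insert_self _ _⟩ (T := insert p T)
    (Finset.insert_subset hp hTR) ?_ rfl
  · rw [Finset.card_insert_of_notMem haJ, Finset.card_insert_of_notMem hpT] at key
    omega
  · intro q hq d
    rcases Finset.mem_insert.1 hq with rfl | hq
    · by_cases hd : d = c
      · subst hd
        exact ⟨a, Finset.mem_insert_self _ _, ha⟩
      · rw [Bool.eq_not.mpr hd]
        obtain ⟨b, hb, hb'⟩ := hc'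
        exact ⟨b, Finset.mem_insert_of_mem hb, hb'⟩
    · obtain ⟨b, hb, hb'⟩ := hT q hq d
      exact ⟨b, Finset.mem_insert_of_mem hb, hb'⟩

lemma IsPresentation.mem_closure_of_latticeHom_eq_zero {A : Finset (Fin m → ℤ)}
    {ρ : Set ((A → ℕ) × (A → ℕ))}
    (hρ : IsPresentation A ρ) {z : A → ℤ} (hz : latticeHom A z = 0) :
    z ∈ AddSubgroup.closure (pairDiff '' ρ) := by
  have h := (hρ.of_factorizationHom_eq (J := ∅) (fun p _ => Or.inr (by simp))
    (factorizationHom_toNat hz) (by simp)).2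
  have hdiff : pairDiff (fun a => (z a).toNat, fun a => (-z a).toNat) = z := by
    ext a
    simp only [pairDiff]
    omega
  simpa [hdiff] using h

lemma groupSpan_closure (X : Set (Fin m → ℤ)) :
    groupSpan (AddSubmonoid.closure X) = AddSubgroup.closure X := by
  refine le_antisymm ?_ (AddSubgroup.closure_mono AddSubmonoid.subset_closure)
  rw [groupSpan, AddSubgroup.closure_le]
  exact AddSubgroup.le_closure_toAddSubmonoid X

/-! ### Cutting along a bridge -/

lemma pairDiff_eq {α : Type*} (p : (α → ℕ) × (α → ℕ)) (b : Bool) :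
    ∃ e : ℤ, pairDiff p = e • fun a => (pairSide p b a : ℤ) - pairSide p (!b) a := by
  cases b
  · refine ⟨-1, ?_⟩
    ext a
    simp [pairDiff, pairSide]
  · refine ⟨1, ?_⟩
    ext a
    simp [pairDiff, pairSide]

lemma latticeHom_pairDiff_closure {A : Finset (Fin m → ℤ)} {R : Set ((A → ℕ) × (A → ℕ))}
    (hφ : ∀ p ∈ R, factorizationHom A p.1 = factorizationHom A p.2) {z : A → ℤ}
    (hz : z ∈ AddSubgroup.closure (pairDiff '' R)) : latticeHom A z = 0 := by
  have : AddSubgroup.closure (pairDiff '' R) ≤ (latticeHom A).ker := by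
    rw [AddSubgroup.closure_le]
    rintro _ ⟨p, hp, rfl⟩
    have : pairDiff p = (fun a => (p.1 a : ℤ)) - fun a => (p.2 a : ℤ) := rfl
    rw [SetLike.mem_coe, AddMonoidHom.mem_ker, this, map_sub, latticeHom_natCast,
      latticeHom_natCast, hφ p hp, sub_self]
  exact this hz

lemma eq_zero_of_mem_pairDiff_closure {α : Type*} [Fintype α] {R : Set ((α → ℕ) × (α → ℕ))}
    {a : α} (hR : ∀ p ∈ R, ∀ c, a ∉ pairSupport p c) {z : α → ℤ}
    (hz : z ∈ AddSubgroup.closure (pairDiff '' R)) : z a = 0 := by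
  have : AddSubgroup.closure (pairDiff '' R) ≤ (Pi.evalAddMonoidHom (fun _ : α => ℤ) a).ker := by
    rw [AddSubgroup.closure_le]
    rintro _ ⟨p, hp, rfl⟩
    have h1 := hR p hp true
    have h2 := hR p hp false
    simp only [mem_pairSupport, pairSide, not_not] at h1 h2
    simp_all [AddMonoidHom.mem_ker, pairDiff]
  exact this hz

lemma exists_latticeHom_eq {A : Finset (Fin m → ℤ)} {B : Finset A} {g : Fin m → ℤ}
    (hg : g ∈ AddSubgroup.closure ((B.image Subtype.val : Finset _) : Set (Fin m → ℤ))) :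
    ∃ z : A → ℤ, (∀ a ∉ B, z a = 0) ∧ latticeHom A z = g := by
  classical
  induction hg using AddSubgroup.closure_induction with
  | mem x hx =>
    simp only [Finset.coe_image, Set.mem_image, Finset.mem_coe] at hx
    obtain ⟨a, ha, rfl⟩ := hx
    refine ⟨Pi.single a 1, fun b hb => Pi.single_eq_of_ne (by rintro rfl; exact hb ha) _, ?_⟩
    rw [latticeHom_apply, Finset.sum_eq_single a]
    · simp
    · intro b _ hb
      simp [hb]
    · simp
  | zero => exact ⟨0, by simp, map_zero _⟩
  | add x y _ _ hx hy =>
    obtain ⟨z, hz, rfl⟩ := hx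
    obtain ⟨z', hz', rfl⟩ := hy
    exact ⟨z + z', fun a ha => by simp [hz a ha, hz' a ha], map_add _ _ _⟩
  | neg x _ hx =>
    obtain ⟨z, hz, rfl⟩ := hx
    exact ⟨-z, fun a ha => by simp [hz a ha], map_neg _ _⟩

lemma factorizationHom_mem_closure {A : Finset (Fin m → ℤ)} {B : Finset A} {u : A → ℕ}
    (hu : ∀ a ∉ B, u a = 0) : factorizationHom A u ∈
      AddSubmonoid.closure ((B.image Subtype.val : Finset _) : Set (Fin m → ℤ)) := by
  rw [factorizationHom_apply]
  refine sum_mem fun a _ => ?_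
  by_cases ha : a ∈ B
  · exact AddSubmonoid.nsmul_mem _ (AddSubmonoid.subset_closure
      (Finset.mem_coe.2 (Finset.mem_image_of_mem _ ha))) _
  · rw [hu a ha, zero_smul]
    exact zero_mem _

lemma linearIndepOn_of_lattice_eq_zero {A : Finset (Fin m → ℤ)} {B : Finset A}
    (h : ∀ z : A → ℤ, (∀ a ∉ B, z a = 0) → latticeHom A z = 0 → z = 0) :
    LinearIndepOn ℚ toRat ((B.image Subtype.val : Finset _) : Set (Fin m → ℤ)) := by
  classical
  rw [linearIndepOn_finset_iff]
  intro q hq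
  rw [Finset.sum_image Subtype.val_injective.injOn] at hq
  obtain ⟨N, hN, z, hz⟩ := exists_nat_mul_eq_intCast (fun a : A => q a)
  let z' : A → ℤ := fun a => if a ∈ B then z a else 0
  have hz' : z' = 0 := by
    refine h z' (fun a ha => by simp [z', ha]) (toRat_injective ?_)
    have h1 : ∀ a : A, toRat (z' a • (a : Fin m → ℤ)) =
        if a ∈ B then (N : ℚ) • q a • toRat (a : Fin m → ℤ) else 0 := by
      intro a
      by_cases ha : a ∈ B
      · rw [toRat_zsmul, smul_smul, hz]
        simp [z', ha]
      · simp [z', ha, toRat_zero]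
    rw [latticeHom_apply, toRat_sum, toRat_zero, Finset.sum_congr rfl fun a _ => h1 a,
      ← Finset.sum_filter, Finset.filter_mem_eq_inter, Finset.univ_inter, ← Finset.smul_sum, hq,
      smul_zero]
  intro i hi
  obtain ⟨a, ha, rfl⟩ := Finset.mem_image.1 hi
  have h1 : z a = 0 := by simpa [z', ha] using congrFun hz' a
  have h2 := hz a
  rw [h1, Int.cast_zero] at h2
  exact (mul_eq_zero.1 h2).resolve_left (by positivity)

/-- A set `B` of generators whose relations are spanned by a sparse family of pairs is obtained by
iterated gluing: a bridge of the family cuts `B` into two parts, which are glued along the common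
value of the two components of the bridge. -/
theorem exists_isIteratedGluing {A : Finset (Fin m → ℤ)} (hA : ∀ a ∈ A, 0 < a)
    {R : Finset ((A → ℕ) × (A → ℕ))} {B : Finset A} (hB : B.Nonempty)
    (hsupp : ∀ p ∈ R, ∀ c, ∀ a ∈ pairSupport p c, a ∈ B)
    (hne : ∀ p ∈ R, ∀ c, (pairSupport p c).Nonempty)
    (hφ : ∀ p ∈ R, factorizationHom A p.1 = factorizationHom A p.2)
    (hsp : IsSparse R pairSupport)
    (hlat : ∀ z : A → ℤ, (∀ a ∉ B, z a = 0) → latticeHom A z = 0 →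
      z ∈ AddSubgroup.closure (pairDiff '' (R : Set ((A → ℕ) × (A → ℕ))))) :
    ∃ D, IsIteratedGluing (B.image Subtype.val) D := by
  classical
  induction hn : R.card using Nat.strong_induction_on generalizing R B with
  | _ n ih =>
  subst hn
  rcases R.eq_empty_or_nonempty with rfl | hR
  · refine ⟨0, .free _ (hB.image _) (linearIndepOn_of_lattice_eq_zero fun z h1 h2 => ?_)⟩
    simpa using hlat z h1 h2
  obtain ⟨i, hi, b, X, hX1, hX2, hX⟩ := hsp.exists_bridge hR
  set u := pairSide i b with hu
  set v := pairSide i (!b) with hv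
  have huv : factorizationHom A u = factorizationHom A v := by
    have := hφ i hi
    cases b <;> simp [hu, hv, pairSide, this]
  let B₁ := B.filter (· ∈ X)
  let B₂ := B.filter (· ∉ X)
  let R₁ := (R.erase i).filter fun p => ∀ c, ∀ a ∈ pairSupport p c, a ∈ X
  let R₂ := (R.erase i).filter fun p => ∀ c, ∀ a ∈ pairSupport p c, a ∉ X
  have hR₁ : R₁ ⊆ R := (Finset.filter_subset _ _).trans (Finset.erase_subset _ _)
  have hR₂ : R₂ ⊆ R := (Finset.filter_subset _ _).trans (Finset.erase_subset _ _)
  have hcard₁ : R₁.card < R.card :=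
    (Finset.card_filter_le _ _).trans_lt (Finset.card_erase_lt_of_mem hi)
  have hcard₂ : R₂.card < R.card :=
    (Finset.card_filter_le _ _).trans_lt (Finset.card_erase_lt_of_mem hi)
  have hs₁ : ∀ p ∈ R₁, ∀ c, ∀ a ∈ pairSupport p c, a ∈ B₁ := fun p hp c a ha =>
    Finset.mem_filter.2 ⟨hsupp p (hR₁ hp) c a ha, (Finset.mem_filter.1 hp).2 c a ha⟩
  have hs₂ : ∀ p ∈ R₂, ∀ c, ∀ a ∈ pairSupport p c, a ∈ B₂ := fun p hp c a ha =>
    Finset.mem_filter.2 ⟨hsupp p (hR₂ hp) c a ha, (Finset.mem_filter.1 hp).2 c a ha⟩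
  have hB12 : Disjoint B₁ B₂ := Finset.disjoint_filter_filter_not _ _ _
  have hBu : B₁ ∪ B₂ = B := Finset.filter_union_filter_not_eq _ _
  have hu₁ : ∀ a ∉ B₁, u a = 0 := by
    intro a ha
    by_contra h
    have h' := mem_pairSupport.2 h
    exact ha (Finset.mem_filter.2 ⟨hsupp i hi b a h', hX1 a h'⟩)
  have hv₂ : ∀ a ∉ B₂, v a = 0 := by
    intro a ha
    by_contra h
    have h' := mem_pairSupport.2 h
    exact ha (Finset.mem_filter.2 ⟨hsupp i hi _ a h', hX2 a h'⟩)
  have hB₁ : B₁.Nonempty := by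
    obtain ⟨a, ha⟩ := hne i hi b
    exact ⟨a, Finset.mem_filter.2 ⟨hsupp i hi b a ha, hX1 a ha⟩⟩
  have hB₂ : B₂.Nonempty := by
    obtain ⟨a, ha⟩ := hne i hi (!b)
    exact ⟨a, Finset.mem_filter.2 ⟨hsupp i hi _ a ha, hX2 a ha⟩⟩
  have hv0 : factorizationHom A v ≠ 0 := by
    intro h
    obtain ⟨a, ha⟩ := hne i hi (!b)
    exact mem_pairSupport.1 ha (congrFun (eq_zero_of_factorizationHom_eq_zero hA h) a)
  set M₁ := AddSubgroup.closure (pairDiff '' (R₁ : Set ((A → ℕ) × (A → ℕ)))) with hM₁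
  set M₂ := AddSubgroup.closure (pairDiff '' (R₂ : Set ((A → ℕ) × (A → ℕ)))) with hM₂
  -- The lattice of relations is the sum of the lattices of the two sides and of `ℤ (u - v)`.
  have hdec : ∀ z : A → ℤ, (∀ a ∉ B, z a = 0) → latticeHom A z = 0 →
      ∃ l₁ ∈ M₁, ∃ l₂ ∈ M₂, ∃ k : ℤ, ∀ a, z a = l₁ a + l₂ a + k * ((u a : ℤ) - v a) := by
    intro z h1 h2
    have h3 := hlat z h1 h2
    clear h1 h2
    induction h3 using AddSubgroup.closure_induction with
    | mem x hx =>
      obtain ⟨p, hp, rfl⟩ := hx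
      by_cases hpi : p = i
      · subst hpi
        obtain ⟨e, he⟩ := pairDiff_eq p b
        exact ⟨0, zero_mem _, 0, zero_mem _, e, fun a => by rw [he]; simp [hu, hv]⟩
      · rcases hX p hp hpi with h | h
        · exact ⟨pairDiff p, AddSubgroup.subset_closure ⟨p, Finset.mem_coe.2
            (Finset.mem_filter.2 ⟨Finset.mem_erase.2 ⟨hpi, hp⟩, h⟩), rfl⟩, 0, zero_mem _, 0,
            fun a => by simp⟩
        · exact ⟨0, zero_mem _, pairDiff p, AddSubgroup.subset_closure ⟨p, Finset.mem_coe.2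
            (Finset.mem_filter.2 ⟨Finset.mem_erase.2 ⟨hpi, hp⟩, h⟩), rfl⟩, 0,
            fun a => by simp⟩
    | zero => exact ⟨0, zero_mem _, 0, zero_mem _, 0, fun a => by simp⟩
    | add x y _ _ hx hy =>
      obtain ⟨l₁, h₁, l₂, h₂, k, hk⟩ := hx
      obtain ⟨l₁', h₁', l₂', h₂', k', hk'⟩ := hy
      refine ⟨l₁ + l₁', add_mem h₁ h₁', l₂ + l₂', add_mem h₂ h₂', k + k', fun a => ?_⟩
      simp only [Pi.add_apply, hk, hk']
      ring
    | neg x _ hx =>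
      obtain ⟨l₁, h₁, l₂, h₂, k, hk⟩ := hx
      refine ⟨-l₁, neg_mem h₁, -l₂, neg_mem h₂, -k, fun a => ?_⟩
      simp only [Pi.neg_apply, hk]
      ring
  have hz₁ : ∀ l ∈ M₁, ∀ a ∉ B₁, l a = 0 := fun l hl a ha =>
    eq_zero_of_mem_pairDiff_closure (fun p hp c h => ha (hs₁ p hp c a h)) hl
  have hz₂ : ∀ l ∈ M₂, ∀ a ∉ B₂, l a = 0 := fun l hl a ha =>
    eq_zero_of_mem_pairDiff_closure (fun p hp c h => ha (hs₂ p hp c a h)) hl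
  have hL₁ : ∀ l ∈ M₁, latticeHom A l = 0 := fun l hl =>
    latticeHom_pairDiff_closure (fun p hp => hφ p (hR₁ hp)) hl
  have hL₂ : ∀ l ∈ M₂, latticeHom A l = 0 := fun l hl =>
    latticeHom_pairDiff_closure (fun p hp => hφ p (hR₂ hp)) hl
  have hnot₁ : ∀ a ∈ B₁, a ∉ B₂ := fun a h => Finset.disjoint_left.1 hB12 h
  have hnot₂ : ∀ a ∈ B₂, a ∉ B₁ := fun a h => Finset.disjoint_right.1 hB12 h
  have hsub₁ : ∀ a ∉ B, a ∉ B₁ := fun a h h' => h (Finset.mem_filter.1 h').1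
  have hsub₂ : ∀ a ∉ B, a ∉ B₂ := fun a h h' => h (Finset.mem_filter.1 h').1
  -- Splitting a difference of vectors supported on the two sides.
  have hsplit : ∀ z₁ z₂ : A → ℤ, (∀ a ∉ B₁, z₁ a = 0) → (∀ a ∉ B₂, z₂ a = 0) →
      latticeHom A z₁ = latticeHom A z₂ → ∃ l₁ ∈ M₁, ∃ l₂ ∈ M₂, ∃ k : ℤ,
        z₁ = l₁ + k • (fun a => (u a : ℤ)) ∧ z₂ = -l₂ + k • (fun a => (v a : ℤ)) := by
    intro z₁ z₂ h1 h2 h12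
    obtain ⟨l₁, hl₁, l₂, hl₂, k, hk⟩ := hdec (z₁ - z₂)
      (fun a ha => by simp [h1 a (hsub₁ a ha), h2 a (hsub₂ a ha)]) (by rw [map_sub, h12, sub_self])
    refine ⟨l₁, hl₁, l₂, hl₂, k, funext fun a => ?_, funext fun a => ?_⟩
    · have := hk a
      by_cases ha : a ∈ B₁
      · have ha' := hnot₁ a ha
        simpa [h2 a ha', hz₂ l₂ hl₂ a ha', hv₂ a ha'] using this
      · simp [h1 a ha, hz₁ l₁ hl₁ a ha, hu₁ a ha]
    · have := hk a
      by_cases ha : a ∈ B₂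
      · have ha' := hnot₂ a ha
        simp only [Pi.sub_apply, h1 a ha', hz₁ l₁ hl₁ a ha', hu₁ a ha'] at this
        simp only [Pi.add_apply, Pi.neg_apply, Pi.smul_apply, smul_eq_mul]
        push_cast at this
        linarith
      · simp [h2 a ha, hz₂ l₂ hl₂ a ha, hv₂ a ha]
  obtain ⟨D₁, hD₁⟩ := ih _ hcard₁ hB₁ hs₁ (fun p hp => hne p (hR₁ hp))
    (fun p hp => hφ p (hR₁ hp)) (hsp.mono hR₁) (by
      intro z h1 h2
      obtain ⟨l₁, hl₁, l₂, hl₂, k, hk, hk'⟩ := hsplit z 0 h1 (fun _ _ => rfl) (by rw [h2, map_zero])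
      have h3 := congrArg (latticeHom A) hk'
      rw [map_zero, map_add, map_neg, hL₂ l₂ hl₂, map_zsmul, latticeHom_natCast, neg_zero,
        zero_add] at h3
      rcases smul_eq_zero.1 h3.symm with h3 | h3
      · rw [hk, h3, zero_smul, add_zero]
        exact hl₁
      · exact absurd h3 hv0) rfl
  obtain ⟨D₂, hD₂⟩ := ih _ hcard₂ hB₂ hs₂ (fun p hp => hne p (hR₂ hp))
    (fun p hp => hφ p (hR₂ hp)) (hsp.mono hR₂) (by
      intro z h1 h2
      obtain ⟨l₁, hl₁, l₂, hl₂, k, hk, hk'⟩ := hsplit 0 z (fun _ _ => rfl) h1 (by rw [h2, map_zero])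
      have h3 := congrArg (latticeHom A) hk
      rw [map_zero, map_add, hL₁ l₁ hl₁, map_zsmul, latticeHom_natCast, zero_add] at h3
      rcases smul_eq_zero.1 h3.symm with h3 | h3
      · rw [hk', h3, zero_smul, add_zero]
        exact neg_mem hl₂
      · exact absurd (huv ▸ h3) hv0) rfl
  refine ⟨factorizationHom A u ::ₘ (D₁ + D₂), ?_⟩
  rw [← hBu, Finset.image_union]
  refine .glue _ _ _ _ _ hD₁ hD₂ ⟨hB₁.image _, hB₂.image _, ?_, factorizationHom_mem_closure hu₁,
    huv ▸ factorizationHom_mem_closure hv₂, ?_⟩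
  · exact (Finset.disjoint_image Subtype.val_injective).2 hB12
  · rw [groupSpan_closure, groupSpan_closure]
    refine le_antisymm ?_ ?_
    · rintro g ⟨hg1, hg2⟩
      obtain ⟨z₁, h1, h1'⟩ := exists_latticeHom_eq hg1
      obtain ⟨z₂, h2, h2'⟩ := exists_latticeHom_eq hg2
      obtain ⟨l₁, hl₁, l₂, hl₂, k, hk, -⟩ := hsplit z₁ z₂ h1 h2 (h1'.trans h2'.symm)
      refine AddSubgroup.mem_zmultiples_iff.2 ⟨k, ?_⟩
      rw [← h1', hk, map_add, hL₁ l₁ hl₁, map_zsmul, latticeHom_natCast, zero_add]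
    · rw [AddSubgroup.zmultiples_le]
      exact ⟨AddSubgroup.le_closure_toAddSubmonoid _ (factorizationHom_mem_closure hu₁),
        AddSubgroup.le_closure_toAddSubmonoid _ (huv ▸ factorizationHom_mem_closure hv₂)⟩

/-! ### Minimal generators and complete intersections -/

lemma IsMinimalGenerating.notMem_closure_diff {S : AddSubmonoid (Fin m → ℤ)}
    {A : Finset (Fin m → ℤ)} (hA : IsMinimalGenerating S A) {a : Fin m → ℤ} (ha : a ∈ A) :
    a ∉ AddSubmonoid.closure ((A : Set (Fin m → ℤ)) \ {a}) := by
  intro h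
  have h1 : AddSubmonoid.closure ((A : Set (Fin m → ℤ)) \ {a}) = S := by
    rw [← hA.prop]
    refine le_antisymm (AddSubmonoid.closure_mono Set.sdiff_subset) ?_
    rw [AddSubmonoid.closure_le]
    intro x hx
    by_cases hxa : x = a
    · rw [hxa]; exact h
    · exact AddSubmonoid.subset_closure ⟨hx, hxa⟩
  exact (hA.le_of_le h1 Set.sdiff_subset ha).2 rfl

lemma IsMinimalGenerating.pos {S : AddSubmonoid (Fin m → ℤ)} (hS : ∀ s ∈ S, 0 ≤ s)
    {A : Finset (Fin m → ℤ)} (hA : IsMinimalGenerating S A) {a : Fin m → ℤ} (ha : a ∈ A) :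
    0 < a := by
  have haS : a ∈ S := by
    rw [← hA.prop]
    exact AddSubmonoid.subset_closure ha
  refine lt_of_le_of_ne (hS a haS) ?_
  rintro rfl
  exact hA.notMem_closure_diff ha (zero_mem _)

/-- In a monoid of nonnegative vectors the minimal generators are indecomposable, hence contained in
every system of generators. -/
lemma IsMinimalGenerating.subset {S : AddSubmonoid (Fin m → ℤ)} (hS : ∀ s ∈ S, 0 ≤ s)
    {A B : Finset (Fin m → ℤ)} (hA : IsMinimalGenerating S A)
    (hB : AddSubmonoid.closure (B : Set (Fin m → ℤ)) = S) : A ⊆ B := by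
  intro a ha
  by_contra haB
  have h1 : ∀ s ∈ AddSubmonoid.closure (A : Set (Fin m → ℤ)),
      s ∈ AddSubmonoid.closure ((A : Set (Fin m → ℤ)) \ {a}) ∨ a ≤ s := by
    intro s hs
    induction hs using AddSubmonoid.closure_induction with
    | mem x hx =>
      by_cases hxa : x = a
      · exact Or.inr hxa.ge
      · exact Or.inl (AddSubmonoid.subset_closure ⟨hx, hxa⟩)
    | zero => exact Or.inl (zero_mem _)
    | add x y hx hy h1 h2 =>
      have hx0 := hS x (hA.prop ▸ hx)
      have hy0 := hS y (hA.prop ▸ hy)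
      rcases h1 with h1 | h1
      · rcases h2 with h2 | h2
        · exact Or.inl (add_mem h1 h2)
        · exact Or.inr (h2.trans (le_add_of_nonneg_left hx0))
      · exact Or.inr (h1.trans (le_add_of_nonneg_right hy0))
  have h2 : ∀ s ∈ AddSubmonoid.closure (B : Set (Fin m → ℤ)),
      s ∈ AddSubmonoid.closure ((A : Set (Fin m → ℤ)) \ {a}) ∨ a < s := by
    intro s hs
    induction hs using AddSubmonoid.closure_induction with
    | mem x hx =>
      have hxS : x ∈ AddSubmonoid.closure (A : Set (Fin m → ℤ)) := by
        rw [show AddSubmonoid.closure (A : Set (Fin m → ℤ)) = S from hA.prop, ← hB]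
        exact AddSubmonoid.subset_closure hx
      rcases h1 x hxS with h | h
      · exact Or.inl h
      · exact Or.inr (lt_of_le_of_ne h (by rintro rfl; exact haB hx))
    | zero => exact Or.inl (zero_mem _)
    | add x y hx hy h1 h2 =>
      have hx0 := hS x (hB ▸ hx)
      have hy0 := hS y (hB ▸ hy)
      rcases h1 with h1 | h1
      · rcases h2 with h2 | h2
        · exact Or.inl (add_mem h1 h2)
        · exact Or.inr (h2.trans_le (le_add_of_nonneg_left hx0))
      · exact Or.inr (h1.trans_le (le_add_of_nonneg_right hy0))
  have haS : a ∈ AddSubmonoid.closure (B : Set (Fin m → ℤ)) := by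
    rw [hB, ← hA.prop]
    exact AddSubmonoid.subset_closure ha
  rcases h2 a haS with h | h
  · exact hA.notMem_closure_diff ha h
  · exact lt_irrefl _ h

lemma IsMinimalGenerating.unique {S : AddSubmonoid (Fin m → ℤ)} (hS : ∀ s ∈ S, 0 ≤ s)
    {A B : Finset (Fin m → ℤ)} (hA : IsMinimalGenerating S A) (hB : IsMinimalGenerating S B) :
    A = B :=
  (hA.subset hS hB.prop).antisymm (hB.subset hS hA.prop)

lemma dimension_closure (X : Set (Fin m → ℤ)) :
    dimension (AddSubmonoid.closure X) = Module.finrank ℚ (Submodule.span ℚ (toRat '' X)) := by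
  have : Submodule.span ℚ (toRat '' (AddSubmonoid.closure X : Set (Fin m → ℤ))) =
      Submodule.span ℚ (toRat '' X) := by
    refine le_antisymm ?_ (Submodule.span_mono (Set.image_mono AddSubmonoid.subset_closure))
    rw [Submodule.span_le]
    rintro _ ⟨x, hx, rfl⟩
    induction hx using AddSubmonoid.closure_induction with
    | mem x hx => exact Submodule.subset_span ⟨x, hx, rfl⟩
    | zero => rw [toRat_zero]; exact Submodule.zero_mem _
    | add x y _ _ hx hy => rw [toRat_add]; exact Submodule.add_mem _ hx hy
  rw [dimension, this]

/-- Pairs with an empty component are trivial and do not contribute to the lattice. -/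
lemma closure_pairDiff_filter
    {A : Finset (Fin m → ℤ)} (hA : ∀ a ∈ A, 0 < a) {R : Finset ((A → ℕ) × (A → ℕ))}
    (hφ : ∀ p ∈ R, factorizationHom A p.1 = factorizationHom A p.2) :
    AddSubgroup.closure (pairDiff '' (R : Set ((A → ℕ) × (A → ℕ)))) ≤
      AddSubgroup.closure (pairDiff ''
        {p | p ∈ R ∧ ∀ c, (pairSupport p c).Nonempty}) := by
  rw [AddSubgroup.closure_le]
  rintro _ ⟨p, hp, rfl⟩
  by_cases h : ∀ c, (pairSupport p c).Nonempty
  · exact AddSubgroup.subset_closure ⟨p, ⟨hp, h⟩, rfl⟩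
  · push Not at h
    obtain ⟨c, hc⟩ := h
    have h0 : pairSide p c = 0 := by
      ext a
      by_contra h
      have := mem_pairSupport.2 h
      simp [hc] at this
    have h1 : p.1 = 0 ∧ p.2 = 0 := by
      have h2 := hφ p hp
      cases c
      · have h0 : p.2 = 0 := h0
        rw [h0, map_zero] at h2
        exact ⟨eq_zero_of_factorizationHom_eq_zero hA h2, h0⟩
      · have h0 : p.1 = 0 := h0
        rw [h0, map_zero] at h2
        exact ⟨h0, eq_zero_of_factorizationHom_eq_zero hA h2.symm⟩
    have : pairDiff p = 0 := by
      ext a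
      simp [pairDiff, h1.1, h1.2]
    rw [this]
    exact zero_mem _

/-- A complete intersection affine semigroup is an iterated gluing of free ones. -/
theorem IsCompleteIntersection.exists_isIteratedGluing {S : AddSubmonoid (Fin m → ℤ)}
    (hS0 : S ≠ ⊥) (hS : IsCompleteIntersection S) {A : Finset (Fin m → ℤ)}
    (hA : IsMinimalGenerating S A) : ∃ D, IsIteratedGluing A D := by
  classical
  obtain ⟨⟨-, hnn⟩, A', hA', ρ, hρ, hcard⟩ := hS
  obtain rfl := hA.unique hnn hA'
  have hpos : ∀ a ∈ A, 0 < a := fun a ha => hA.pos hnn ha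
  have hne : A.Nonempty := by
    rw [Finset.nonempty_iff_ne_empty]
    rintro rfl
    apply hS0
    rw [← hA.prop]
    simp
  have hfin : ρ.Finite := by
    rw [← Set.encard_ne_top_iff]
    intro h
    simp [h] at hcard
  obtain ⟨R, rfl⟩ := hfin.exists_finset_coe
  rw [Set.encard_coe_eq_coe_finsetCard] at hcard
  have hdim : R.card + Module.finrank ℚ (Submodule.span ℚ (toRat '' (A : Set (Fin m → ℤ)))) =
      A.card := by
    rw [← dimension_closure, show AddSubmonoid.closure (A : Set (Fin m → ℤ)) = S from hA.prop]
    exact_mod_cast hcard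
  have hpres : IsPresentation A (R : Set ((A → ℕ) × (A → ℕ))) := hρ.prop
  have hφ : ∀ p ∈ R, factorizationHom A p.1 = factorizationHom A p.2 := by
    intro p hp
    have h : addConGen (fun u v => (u, v) ∈ (R : Set ((A → ℕ) × (A → ℕ)))) p.1 p.2 :=
      AddConGen.Rel.of _ _ hp
    rw [show addConGen (fun u v => (u, v) ∈ (R : Set ((A → ℕ) × (A → ℕ)))) = _ from hpres] at h
    exact h
  let R' := R.filter fun p => ∀ c, (pairSupport p c).Nonempty
  have hR' : R' ⊆ R := Finset.filter_subset _ _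
  have huniv : (Finset.univ : Finset A).image Subtype.val = A := by
    ext a; simp
  have hAne : (Finset.univ : Finset A).Nonempty := by
    obtain ⟨a, ha⟩ := hne
    exact ⟨⟨a, ha⟩, Finset.mem_univ _⟩
  rw [← huniv]
  refine AffineSemigroup.exists_isIteratedGluing hpos (R := R') hAne
    (fun p hp c a _ => Finset.mem_univ a)
    (fun p hp => (Finset.mem_filter.1 hp).2) (fun p hp => hφ p (hR' hp))
    ((hpres.isSparse hpos hφ hdim).mono hR') (fun z _ hz => ?_)
  have h := closure_pairDiff_filter hpos hφ (hpres.mem_closure_of_latticeHom_eq_zero hz)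
  simpa [R'] using h

/-! ### Positive combinations and gluings -/

/-- The linear combinations with positive rational coefficients of the vectors in `A`. -/
def posCombos (A : Finset (Fin m → ℤ)) : Set (Fin m → ℚ) :=
  {x | ∃ q : (Fin m → ℤ) → ℚ, (∀ a ∈ A, 0 < q a) ∧ x = ∑ a ∈ A, q a • toRat a}

/-- The linear combinations with nonnegative rational coefficients of the vectors in `A`. -/
def nonnegCombos (A : Finset (Fin m → ℤ)) : Set (Fin m → ℚ) :=
  {x | ∃ q : (Fin m → ℤ) → ℚ, (∀ a ∈ A, 0 ≤ q a) ∧ x = ∑ a ∈ A, q a • toRat a}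

section Combos

variable {A A₁ A₂ : Finset (Fin m → ℤ)} {x y : Fin m → ℚ}

lemma posCombos_subset_nonnegCombos : posCombos A ⊆ nonnegCombos A := by
  rintro _ ⟨q, hq, rfl⟩
  exact ⟨q, fun a ha => (hq a ha).le, rfl⟩

lemma add_mem_posCombos (hx : x ∈ posCombos A) (hy : y ∈ nonnegCombos A) :
    x + y ∈ posCombos A := by
  obtain ⟨p, hp, rfl⟩ := hx
  obtain ⟨q, hq, rfl⟩ := hy
  exact ⟨p + q, fun a ha => add_pos_of_pos_of_nonneg (hp a ha) (hq a ha),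
    by simp [add_smul, Finset.sum_add_distrib]⟩

lemma smul_mem_posCombos {c : ℚ} (hc : 0 < c) (hx : x ∈ posCombos A) : c • x ∈ posCombos A := by
  obtain ⟨p, hp, rfl⟩ := hx
  exact ⟨fun a => c * p a, fun a ha => mul_pos hc (hp a ha), by simp [Finset.smul_sum, mul_smul]⟩

lemma smul_mem_nonnegCombos {c : ℚ} (hc : 0 ≤ c) (hx : x ∈ nonnegCombos A) :
    c • x ∈ nonnegCombos A := by
  obtain ⟨p, hp, rfl⟩ := hx
  exact ⟨fun a => c * p a, fun a ha => mul_nonneg hc (hp a ha),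
    by simp [Finset.smul_sum, mul_smul]⟩

lemma toRat_mem_nonnegCombos {x : Fin m → ℤ}
    (hx : x ∈ AddSubmonoid.closure (A : Set (Fin m → ℤ))) : toRat x ∈ nonnegCombos A := by
  obtain ⟨n, -, rfl⟩ := AddSubmonoid.mem_closure_finset.1 hx
  refine ⟨fun a => n a, fun a _ => Nat.cast_nonneg _, ?_⟩
  simp only [toRat_sum, toRat_nsmul]

lemma add_mem_posCombos_union (h : Disjoint A₁ A₂) (hx : x ∈ posCombos A₁)
    (hy : y ∈ posCombos A₂) : x + y ∈ posCombos (A₁ ∪ A₂) := by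
  classical
  obtain ⟨p, hp, rfl⟩ := hx
  obtain ⟨q, hq, rfl⟩ := hy
  refine ⟨fun a => if a ∈ A₁ then p a else q a, fun a ha => ?_, ?_⟩
  · dsimp only
    split_ifs with h1
    · exact hp a h1
    · exact hq a ((Finset.mem_union.1 ha).resolve_left h1)
  · rw [Finset.sum_union h]
    congr 1
    · exact Finset.sum_congr rfl fun a ha => by simp only [if_pos ha]
    · exact Finset.sum_congr rfl fun a ha => by
        simp only [if_neg (Finset.disjoint_right.1 h ha)]

lemma exists_add_of_mem_posCombos_union (h : Disjoint A₁ A₂) (hx : x ∈ posCombos (A₁ ∪ A₂)) :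
    ∃ q : (Fin m → ℤ) → ℚ, (∀ a ∈ A₁, 0 < q a) ∧ (∀ a ∈ A₂, 0 < q a) ∧
      x = ∑ a ∈ A₁, q a • toRat a + ∑ a ∈ A₂, q a • toRat a := by
  obtain ⟨q, hq, rfl⟩ := hx
  exact ⟨q, fun a ha => hq a (Finset.mem_union_left _ ha),
    fun a ha => hq a (Finset.mem_union_right _ ha), Finset.sum_union h⟩

/-- Positive combinations form a relatively open set. -/
lemma exists_add_smul_mem_posCombos (hx : x ∈ posCombos A) (c : (Fin m → ℤ) → ℚ) :
    ∃ ε₀ : ℚ, 0 < ε₀ ∧ ∀ ε, 0 ≤ ε → ε ≤ ε₀ → x + ε • ∑ a ∈ A, c a • toRat a ∈ posCombos A := by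
  obtain ⟨q, hq, rfl⟩ := hx
  have hnn : ∀ a ∈ A, 0 ≤ |c a| / q a := fun a ha => div_nonneg (abs_nonneg _) (hq a ha).le
  have hs : 0 < 1 + ∑ a ∈ A, |c a| / q a := by
    have := Finset.sum_nonneg hnn
    linarith
  refine ⟨(1 + ∑ a ∈ A, |c a| / q a)⁻¹, inv_pos.2 hs, fun ε h0 h1 => ?_⟩
  refine ⟨fun a => q a + ε * c a, fun a ha => ?_, ?_⟩
  · have h2 : |c a| / q a < 1 + ∑ a ∈ A, |c a| / q a := by
      have := Finset.single_le_sum hnn ha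
      linarith
    rw [div_lt_iff₀ (hq a ha)] at h2
    have h3 : ε * |c a| < q a := by
      calc ε * |c a| ≤ (1 + ∑ a ∈ A, |c a| / q a)⁻¹ * |c a| :=
            mul_le_mul_of_nonneg_right h1 (abs_nonneg _)
        _ < q a := by rwa [inv_mul_lt_iff₀ hs]
    have h4 : -(ε * |c a|) ≤ ε * c a := by
      rw [← mul_neg]
      exact mul_le_mul_of_nonneg_left (neg_abs_le _) h0
    dsimp only
    linarith
  · simp [add_smul, Finset.sum_add_distrib, Finset.smul_sum, mul_smul]

end Combos

lemma exists_int_combination {A : Finset (Fin m → ℤ)} {g : Fin m → ℤ}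
    (hg : g ∈ AddSubgroup.closure (A : Set (Fin m → ℤ))) :
    ∃ z : (Fin m → ℤ) → ℤ, g = ∑ a ∈ A, z a • a := by
  classical
  induction hg using AddSubgroup.closure_induction with
  | mem x hx =>
    refine ⟨Pi.single x 1, ?_⟩
    rw [Finset.sum_eq_single x]
    · simp
    · intro b _ hb
      rw [Pi.single_eq_of_ne hb, zero_smul]
    · exact fun h => absurd hx h
  | zero => exact ⟨0, by simp⟩
  | add x y _ _ hx hy =>
    obtain ⟨z, rfl⟩ := hx
    obtain ⟨z', rfl⟩ := hy
    exact ⟨z + z', by simp [add_smul, Finset.sum_add_distrib]⟩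
  | neg x _ hx =>
    obtain ⟨z, rfl⟩ := hx
    exact ⟨-z, by simp⟩

lemma sum_zsmul_mem_closure (A : Finset (Fin m → ℤ)) (z : (Fin m → ℤ) → ℤ) :
    ∑ a ∈ A, z a • a ∈ AddSubgroup.closure (A : Set (Fin m → ℤ)) :=
  sum_mem fun _ ha => zsmul_mem (AddSubgroup.subset_closure ha) _

lemma sum_nsmul_mem_closure (A : Finset (Fin m → ℤ)) (n : (Fin m → ℤ) → ℕ) :
    ∑ a ∈ A, n a • a ∈ AddSubmonoid.closure (A : Set (Fin m → ℤ)) :=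
  sum_mem fun _ ha => nsmul_mem (AddSubmonoid.subset_closure ha) _

lemma gluingVector_add_mem_of_linearIndepOn {A : Finset (Fin m → ℤ)}
    (hA : LinearIndepOn ℚ toRat (A : Set (Fin m → ℤ))) {g : Fin m → ℤ}
    (hg : g ∈ AddSubgroup.closure (A : Set (Fin m → ℤ))) (hpos : toRat g ∈ posCombos A) :
    gluingVector A 0 + g ∈ AddSubmonoid.closure (A : Set (Fin m → ℤ)) := by
  obtain ⟨z, rfl⟩ := exists_int_combination hg
  obtain ⟨q, hq, hzq⟩ := hpos
  simp only [toRat_sum, toRat_zsmul] at hzq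
  have h := linearIndepOn_finset_iffₛ.1 hA _ _ hzq
  have h1 : ∀ a ∈ A, 1 ≤ z a := by
    intro a ha
    have h2 := hq a ha
    rw [← h a ha] at h2
    exact_mod_cast h2
  have h2 : gluingVector A 0 + ∑ a ∈ A, z a • a = ∑ a ∈ A, (z a - 1).toNat • a := by
    rw [gluingVector, Multiset.sum_zero, zero_sub, neg_add_eq_sub, ← Finset.sum_sub_distrib]
    refine Finset.sum_congr rfl fun a ha => ?_
    rw [← natCast_zsmul, Int.toNat_of_nonneg (by linarith [h1 a ha]), sub_smul, one_smul]
  rw [h2]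
  exact sum_nsmul_mem_closure A _

lemma mem_posCombos_of_linearIndepOn {A : Finset (Fin m → ℤ)}
    (hA : LinearIndepOn ℚ toRat (A : Set (Fin m → ℤ))) {w : Fin m → ℤ}
    (hw : w ∈ AddSubmonoid.closure (A : Set (Fin m → ℤ)))
    (hf : gluingVector A 0 + w ∈ AddSubmonoid.closure (A : Set (Fin m → ℤ))) :
    toRat w ∈ posCombos A := by
  obtain ⟨n, -, rfl⟩ := AddSubmonoid.mem_closure_finset.1 hw
  obtain ⟨n', -, h⟩ := AddSubmonoid.mem_closure_finset.1 hf
  have h1 : ∑ a ∈ A, ((n' a : ℚ) + 1) • toRat a = ∑ a ∈ A, (n a : ℚ) • toRat a := by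
    have h2 := congrArg toRat h
    rw [gluingVector, Multiset.sum_zero, zero_sub, neg_add_eq_sub, toRat_sub] at h2
    simp only [toRat_sum, toRat_nsmul] at h2
    simp only [add_smul, one_smul, Finset.sum_add_distrib, h2, sub_add_cancel]
  refine ⟨fun a => n a, fun a ha => ?_, by simp only [toRat_sum, toRat_nsmul]⟩
  have h2 := linearIndepOn_finset_iffₛ.1 hA _ _ h1 a ha
  simp only [← h2]
  positivity

lemma gluingVector_union {A₁ A₂ : Finset (Fin m → ℤ)} (h : Disjoint A₁ A₂)
    (D₁ D₂ : Multiset (Fin m → ℤ)) (d : Fin m → ℤ) :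
    gluingVector (A₁ ∪ A₂) (d ::ₘ (D₁ + D₂)) = gluingVector A₁ D₁ + gluingVector A₂ D₂ + d := by
  rw [gluingVector, gluingVector, gluingVector, Finset.sum_union h, Multiset.sum_cons,
    Multiset.sum_add]
  abel

/-- In a gluing along `d`, write an element of the group of `⟨A₁ ∪ A₂⟩` in the relative interior
as `g₁ + g₂` with `gᵢ` in the groups of the two parts, and as a sum of rational elements of the
two relative interiors. These differ by a rational multiple of `d`, and rounding it shows that
`g₁` and `g₂ + d` may be taken in the relative interiors. -/
lemma IsGluing.exists_add {A₁ A₂ : Finset (Fin m → ℤ)} {d : Fin m → ℤ} (hd : IsGluing A₁ A₂ d)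
    {g : Fin m → ℤ} (hg : g ∈ AddSubgroup.closure ((A₁ ∪ A₂ : Finset _) : Set (Fin m → ℤ)))
    (hpos : toRat g ∈ posCombos (A₁ ∪ A₂)) :
    ∃ g₁ ∈ AddSubgroup.closure (A₁ : Set (Fin m → ℤ)),
      ∃ g₂ ∈ AddSubgroup.closure (A₂ : Set (Fin m → ℤ)), g = g₁ + g₂ ∧
        toRat g₁ ∈ posCombos A₁ ∧ toRat (g₂ + d) ∈ posCombos A₂ := by
  obtain ⟨-, -, hdisj, hd₁, hd₂, hG⟩ := hd
  rw [groupSpan_closure, groupSpan_closure] at hG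
  rw [Finset.coe_union, AddSubgroup.closure_union, AddSubgroup.mem_sup] at hg
  obtain ⟨g₁, hg₁, g₂, hg₂, rfl⟩ := hg
  obtain ⟨q, hq₁, hq₂, hq⟩ := exists_add_of_mem_posCombos_union hdisj hpos
  obtain ⟨N, hN, z, hz⟩ := exists_nat_mul_eq_intCast_of_mem (A₁ ∪ A₂) q
  have hN0 : (N : ℚ) ≠ 0 := by positivity
  have hsum : ∀ B ⊆ A₁ ∪ A₂, toRat (∑ a ∈ B, z a • a) = (N : ℚ) • ∑ a ∈ B, q a • toRat a := by
    intro B hB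
    rw [toRat_sum, Finset.smul_sum]
    refine Finset.sum_congr rfl fun a ha => ?_
    rw [toRat_zsmul, smul_smul, hz a (hB ha)]
  set x₁ := ∑ a ∈ A₁, q a • toRat a with hx₁
  set x₂ := ∑ a ∈ A₂, q a • toRat a with hx₂
  have h1 := hsum A₁ Finset.subset_union_left
  have h2 := hsum A₂ Finset.subset_union_right
  rw [toRat_add] at hq
  have hmem : (N : ℕ) • g₁ - ∑ a ∈ A₁, z a • a ∈ AddSubgroup.zmultiples d := by
    rw [← hG]
    refine AddSubgroup.mem_inf.2 ⟨sub_mem (nsmul_mem hg₁ _) (sum_zsmul_mem_closure _ _), ?_⟩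
    have : (N : ℕ) • g₁ - ∑ a ∈ A₁, z a • a = ∑ a ∈ A₂, z a • a - N • g₂ := by
      apply toRat_injective
      rw [toRat_sub, toRat_sub, toRat_nsmul, toRat_nsmul, h1, h2, sub_eq_sub_iff_add_eq_add,
        ← smul_add, ← smul_add, hq, add_comm]
    rw [this]
    exact sub_mem (sum_zsmul_mem_closure _ _) (nsmul_mem hg₂ _)
  obtain ⟨k, hk⟩ := AddSubgroup.mem_zmultiples_iff.1 hmem
  set α : ℚ := k / N with hα
  have hg₁x : toRat g₁ = x₁ + α • toRat d := by
    have h3 := congrArg toRat hk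
    rw [toRat_sub, toRat_zsmul, toRat_nsmul, h1, ← smul_sub] at h3
    have h4 : toRat g₁ - x₁ = (N : ℚ)⁻¹ • ((k : ℚ) • toRat d) := by
      rw [h3, smul_smul, inv_mul_cancel₀ hN0, one_smul]
    rw [hα, div_eq_inv_mul, mul_smul, ← h4]
    abel
  have hg₂x : toRat g₂ = x₂ - α • toRat d := by
    rw [hg₁x] at hq
    rw [eq_sub_iff_add_eq]
    rw [add_assoc, add_left_cancel_iff, add_comm] at hq
    exact hq
  have hdG₁ : d ∈ AddSubgroup.closure (A₁ : Set (Fin m → ℤ)) :=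
    AddSubgroup.le_closure_toAddSubmonoid _ hd₁
  have hdG₂ : d ∈ AddSubgroup.closure (A₂ : Set (Fin m → ℤ)) :=
    AddSubgroup.le_closure_toAddSubmonoid _ hd₂
  refine ⟨g₁ - ⌊α⌋ • d, sub_mem hg₁ (zsmul_mem hdG₁ _), g₂ + ⌊α⌋ • d,
    add_mem hg₂ (zsmul_mem hdG₂ _), by abel, ?_, ?_⟩
  · have : toRat (g₁ - ⌊α⌋ • d) = x₁ + Int.fract α • toRat d := by
      rw [toRat_sub, toRat_zsmul, hg₁x, Int.fract, sub_smul]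
      abel
    rw [this]
    exact add_mem_posCombos ⟨q, hq₁, hx₁⟩
      (smul_mem_nonnegCombos (Int.fract_nonneg _) (toRat_mem_nonnegCombos hd₁))
  · have : toRat (g₂ + ⌊α⌋ • d + d) = x₂ + (1 - Int.fract α) • toRat d := by
      rw [toRat_add, toRat_add, toRat_zsmul, hg₂x, Int.fract]
      module
    rw [this]
    exact add_mem_posCombos ⟨q, hq₂, hx₂⟩
      (smul_mem_nonnegCombos (by linarith [Int.fract_lt_one α]) (toRat_mem_nonnegCombos hd₂))

/-- If `w₁` is in the relative interior of the first part of a gluing along `d`, a small multiple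
of `d` may be moved from it to the second part, which puts `w₂` in the relative interior there if
adding a larger multiple of `d` does. -/
lemma add_mem_posCombos_union_of_shift {A₁ A₂ : Finset (Fin m → ℤ)} (hdisj : Disjoint A₁ A₂)
    {d : Fin m → ℤ} (hd₁ : d ∈ AddSubmonoid.closure (A₁ : Set (Fin m → ℤ)))
    {w₁ w₂ : Fin m → ℤ} (hw₁ : toRat w₁ ∈ posCombos A₁)
    (hw₂ : w₂ ∈ AddSubmonoid.closure (A₂ : Set (Fin m → ℤ))) {k : ℕ} (hk : 0 < k)
    (hw₂k : toRat (w₂ + k • d) ∈ posCombos A₂) :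
    toRat (w₁ + w₂) ∈ posCombos (A₁ ∪ A₂) := by
  obtain ⟨c, -, hc⟩ := toRat_mem_nonnegCombos hd₁
  obtain ⟨ε₀, hε₀, h⟩ := exists_add_smul_mem_posCombos hw₁ (fun a => -c a)
  have hk' : (0 : ℚ) < k := by exact_mod_cast hk
  let δ : ℚ := min (ε₀ / k) 1
  have hδ0 : 0 < δ := lt_min (by positivity) one_pos
  have hδ1 : δ ≤ 1 := min_le_right _ _
  have hδk : δ * k ≤ ε₀ := by
    rw [← le_div_iff₀ hk']
    exact min_le_left _ _
  have h1 := h (δ * k) (by positivity) hδk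
  simp only [neg_smul, Finset.sum_neg_distrib, ← hc] at h1
  have h2 : (δ • toRat (w₂ + k • d) + (1 - δ) • toRat w₂) ∈ posCombos A₂ :=
    add_mem_posCombos (smul_mem_posCombos hδ0 hw₂k)
      (smul_mem_nonnegCombos (by linarith) (toRat_mem_nonnegCombos hw₂))
  have h3 := add_mem_posCombos_union hdisj h1 h2
  have h4 : toRat (w₁ + w₂) = (toRat w₁ + (δ * k) • -toRat d) +
      (δ • toRat (w₂ + k • d) + (1 - δ) • toRat w₂) := by
    rw [toRat_add, toRat_add, toRat_nsmul]
    module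
  rw [h4]
  exact h3

lemma IsIteratedGluing.gluingVector_mem {A : Finset (Fin m → ℤ)} {D : Multiset (Fin m → ℤ)}
    (h : IsIteratedGluing A D) :
    gluingVector A D ∈ AddSubgroup.closure (A : Set (Fin m → ℤ)) := by
  induction h with
  | free A hne hA =>
    rw [gluingVector, Multiset.sum_zero, zero_sub]
    exact neg_mem (sum_mem fun a ha => AddSubgroup.subset_closure ha)
  | glue A₁ A₂ D₁ D₂ d _ _ hd ih₁ ih₂ =>
    rw [gluingVector_union hd.2.2.1, Finset.coe_union, AddSubgroup.closure_union]
    have hd' : d ∈ AddSubgroup.closure (A₁ : Set (Fin m → ℤ)) :=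
      AddSubgroup.le_closure_toAddSubmonoid _ hd.2.2.2.1
    exact add_mem (add_mem (AddSubgroup.mem_sup_left ih₁) (AddSubgroup.mem_sup_right ih₂))
      (AddSubgroup.mem_sup_left hd')

/-- The vector `f = ∑ d_i - ∑ a` has the absorption property of a Frobenius vector. -/
theorem IsIteratedGluing.gluingVector_add_mem {A : Finset (Fin m → ℤ)} {D : Multiset (Fin m → ℤ)}
    (h : IsIteratedGluing A D) : ∀ g ∈ AddSubgroup.closure (A : Set (Fin m → ℤ)),
      toRat g ∈ posCombos A →
      gluingVector A D + g ∈ AddSubmonoid.closure (A : Set (Fin m → ℤ)) := by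
  induction h with
  | free A hne hA => exact fun g hg hpos => gluingVector_add_mem_of_linearIndepOn hA hg hpos
  | glue A₁ A₂ D₁ D₂ d _ _ hd ih₁ ih₂ =>
    intro g hg hpos
    obtain ⟨g₁, hg₁, g₂, hg₂, rfl, h₁, h₂⟩ := hd.exists_add hg hpos
    obtain ⟨-, -, hdisj, -, hd₂, -⟩ := hd
    have hd₂' : d ∈ AddSubgroup.closure (A₂ : Set (Fin m → ℤ)) :=
      AddSubgroup.le_closure_toAddSubmonoid _ hd₂
    have h3 := ih₁ g₁ hg₁ h₁
    have h4 := ih₂ (g₂ + d) (AddMemClass.add_mem hg₂ hd₂') h₂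
    rw [gluingVector_union hdisj, Finset.coe_union, AddSubmonoid.closure_union,
      show gluingVector A₁ D₁ + gluingVector A₂ D₂ + d + (g₁ + g₂) =
        (gluingVector A₁ D₁ + g₁) + (gluingVector A₂ D₂ + (g₂ + d)) by abel]
    exact AddMemClass.add_mem (AddSubmonoid.mem_sup_left h3) (AddSubmonoid.mem_sup_right h4)

/-- The elements `w` of the semigroup for which `f + w` belongs to it lie in the relative
interior, where `f = ∑ d_i - ∑ a`. For linearly independent generators all coefficients of such a
`w` must be positive; in a gluing along `d`, comparing the components of `f + w` in the two parts
shows that one component of `w` is in the relative interior, and the other one is after adding a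
multiple of `d`. -/
theorem IsIteratedGluing.mem_posCombos {A : Finset (Fin m → ℤ)} {D : Multiset (Fin m → ℤ)}
    (h : IsIteratedGluing A D) : ∀ w ∈ AddSubmonoid.closure (A : Set (Fin m → ℤ)),
      gluingVector A D + w ∈ AddSubmonoid.closure (A : Set (Fin m → ℤ)) →
      toRat w ∈ posCombos A := by
  induction h with
  | free A hne hA => exact fun w hw hf => mem_posCombos_of_linearIndepOn hA hw hf
  | glue A₁ A₂ D₁ D₂ d h₁ h₂ hd ih₁ ih₂ =>
    obtain ⟨-, -, hdisj, hd₁, hd₂, hG⟩ := hd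
    rw [groupSpan_closure, groupSpan_closure] at hG
    intro w hw hf
    rw [gluingVector_union hdisj] at hf
    rw [Finset.coe_union, AddSubmonoid.closure_union, AddSubmonoid.mem_sup] at hw hf
    obtain ⟨w₁, hw₁, w₂, hw₂, rfl⟩ := hw
    obtain ⟨s₁, hs₁, s₂, hs₂, hs⟩ := hf
    have hmem : gluingVector A₁ D₁ + w₁ + d - s₁ ∈ AddSubgroup.zmultiples d := by
      have hG₁ := AddSubgroup.le_closure_toAddSubmonoid (A₁ : Set (Fin m → ℤ))
      have hG₂ := AddSubgroup.le_closure_toAddSubmonoid (A₂ : Set (Fin m → ℤ))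
      rw [← hG]
      refine AddSubgroup.mem_inf.2 ⟨sub_mem (AddMemClass.add_mem
        (AddMemClass.add_mem h₁.gluingVector_mem (hG₁ hw₁)) (hG₁ hd₁)) (hG₁ hs₁), ?_⟩
      rw [show gluingVector A₁ D₁ + w₁ + d - s₁ = s₂ - gluingVector A₂ D₂ - w₂ by
        rw [eq_sub_iff_add_eq, eq_sub_iff_add_eq, sub_add_eq_add_sub, sub_add_eq_add_sub,
          sub_eq_iff_eq_add', hs]
        abel]
      exact sub_mem (sub_mem (hG₂ hs₂) h₂.gluingVector_mem) (hG₂ hw₂)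
    -- The sign of `k` decides which of the two parts keeps its element in the semigroup.
    obtain ⟨k, hk⟩ := AddSubgroup.mem_zmultiples_iff.1 hmem
    have e₁ : gluingVector A₁ D₁ + w₁ = s₁ + (k - 1) • d := by
      rw [sub_smul, hk, one_smul]
      abel
    have e₂ : gluingVector A₂ D₂ + w₂ = s₂ - k • d := by
      rw [hk, eq_sub_iff_add_eq, add_sub_assoc', sub_eq_iff_eq_add', hs]
      abel
    rcases le_or_gt k 0 with hk0 | hk0
    · obtain ⟨n, rfl⟩ : ∃ n : ℕ, k = -n := ⟨k.natAbs, by omega⟩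
      have h3 := ih₂ w₂ hw₂ (by
        rw [e₂, neg_smul, sub_neg_eq_add, natCast_zsmul]
        exact AddMemClass.add_mem hs₂ (nsmul_mem hd₂ _))
      have h4 := ih₁ (w₁ + (n + 1) • d) (AddMemClass.add_mem hw₁ (nsmul_mem hd₁ _)) (by
        rw [← add_assoc, e₁, ← natCast_zsmul, add_assoc, ← add_smul]
        push_cast
        rw [show -(n : ℤ) - 1 + (n + 1) = 0 by ring, zero_smul, add_zero]
        exact hs₁)
      rw [Finset.union_comm, add_comm]
      exact add_mem_posCombos_union_of_shift hdisj.symm hd₂ h3 hw₁ n.succ_pos h4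
    · obtain ⟨n, rfl⟩ : ∃ n : ℕ, k = n + 1 := ⟨(k - 1).natAbs, by omega⟩
      have h3 := ih₁ w₁ hw₁ (by
        rw [e₁, add_sub_cancel_right, natCast_zsmul]
        exact AddMemClass.add_mem hs₁ (nsmul_mem hd₁ _))
      have h4 := ih₂ (w₂ + (n + 1) • d) (AddMemClass.add_mem hw₂ (nsmul_mem hd₂ _)) (by
        rw [← add_assoc, e₂, ← natCast_zsmul]
        push_cast
        rw [sub_add_cancel]
        exact hs₂)
      exact add_mem_posCombos_union_of_shift hdisj hd₁ h3 hw₂ n.succ_pos h4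

/-! ### Finitely generated cones and the minimality of the Frobenius vector -/

lemma mem_nonnegCombos_insert {A : Finset (Fin m → ℤ)} {a : Fin m → ℤ}
    (ha : a ∉ A) {x : Fin m → ℚ} :
    x ∈ nonnegCombos (insert a A) ↔ ∃ t : ℚ, 0 ≤ t ∧ x - t • toRat a ∈ nonnegCombos A := by
  classical
  constructor
  · rintro ⟨q, hq, rfl⟩
    refine ⟨q a, hq a (Finset.mem_insert_self _ _), q,
      fun b hb => hq b (Finset.mem_insert_of_mem hb), ?_⟩
    rw [Finset.sum_insert ha, add_sub_cancel_left]
  · rintro ⟨t, ht, q, hq, h⟩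
    refine ⟨Function.update q a t, fun b hb => ?_, ?_⟩
    · by_cases hba : b = a
      · rw [hba, Function.update_self]
        exact ht
      · rw [Function.update_of_ne hba]
        exact hq b (Finset.mem_of_mem_insert_of_ne hb hba)
    · rw [Finset.sum_insert ha, Function.update_self, ← sub_eq_iff_eq_add', h]
      refine Finset.sum_congr rfl fun b hb => ?_
      rw [Function.update_of_ne (by rintro rfl; exact ha hb)]

/-- A finitely generated cone is the intersection of finitely many half-spaces, by Fourier–Motzkin
elimination. -/
theorem exists_halfspaces_eq_nonnegCombos (A : Finset (Fin m → ℤ)) :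
    ∃ H : Finset (Module.Dual ℚ (Fin m → ℚ)), ∀ x, x ∈ nonnegCombos A ↔ ∀ h ∈ H, 0 ≤ h x := by
  classical
  induction A using Finset.induction_on with
  | empty =>
    refine ⟨Finset.univ.image (fun i => LinearMap.proj i) ∪
      Finset.univ.image (fun i => -LinearMap.proj i), fun x => ?_⟩
    have h1 : x ∈ nonnegCombos (∅ : Finset (Fin m → ℤ)) ↔ x = 0 := by
      simp [nonnegCombos]
    rw [h1]
    constructor
    · rintro rfl h _
      simp
    · intro h
      ext i
      have h2 := h _ (Finset.mem_union_left _ (Finset.mem_image_of_mem _ (Finset.mem_univ i)))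
      have h3 := h _ (Finset.mem_union_right _ (Finset.mem_image_of_mem _ (Finset.mem_univ i)))
      simp only [LinearMap.proj_apply, LinearMap.neg_apply] at h2 h3
      simp only [Pi.zero_apply]
      linarith
  | insert a A ha ih =>
    obtain ⟨H, hH⟩ := ih
    set v := toRat a
    refine ⟨H.filter (fun h => 0 ≤ h v) ∪
      ((H.filter (fun h => h v < 0)) ×ˢ (H.filter (fun h => 0 < h v))).image
        (fun p => p.2 v • p.1 - p.1 v • p.2), fun x => ?_⟩
    rw [mem_nonnegCombos_insert ha]
    simp only [hH, map_sub, map_smul, smul_eq_mul]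
    constructor
    · rintro ⟨t, ht, h⟩ f hf
      rcases Finset.mem_union.1 hf with hf | hf
      · rw [Finset.mem_filter] at hf
        nlinarith [h f hf.1, mul_nonneg ht hf.2]
      · obtain ⟨⟨f₁, f₂⟩, hp, rfl⟩ := Finset.mem_image.1 hf
        simp only [Finset.mem_product, Finset.mem_filter] at hp
        obtain ⟨⟨hf₁, hn⟩, hf₂, hp⟩ := hp
        simp only [LinearMap.sub_apply, LinearMap.smul_apply, smul_eq_mul]
        nlinarith [mul_nonneg hp.le (h f₁ hf₁), mul_nonneg (neg_nonneg.2 hn.le) (h f₂ hf₂)]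
    · intro h
      -- The largest lower bound imposed on `t` by `0 ≤ t` and by the `f` with `f v < 0`.
      let T : Finset ℚ := insert 0 ((H.filter (fun f => f v < 0)).image fun f => f x / f v)
      have hT : T.Nonempty := ⟨0, Finset.mem_insert_self _ _⟩
      refine ⟨T.max' hT, T.le_max' _ (Finset.mem_insert_self _ _), fun f hf => ?_⟩
      have htT := T.max'_mem hT
      have hle : ∀ s ∈ T, s ≤ T.max' hT := fun s hs => T.le_max' s hs
      generalize T.max' hT = t at htT hle
      rcases lt_trichotomy (f v) 0 with hfv | hfv | hfv
      · have h1 := hle (f x / f v) (Finset.mem_insert_of_mem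
          (Finset.mem_image_of_mem _ (Finset.mem_filter.2 ⟨hf, hfv⟩)))
        rw [div_le_iff_of_neg hfv] at h1
        linarith
      · have h1 := h f (Finset.mem_union_left _ (Finset.mem_filter.2 ⟨hf, hfv.ge⟩))
        rw [hfv]
        linarith
      · rcases Finset.mem_insert.1 htT with rfl | htT
        · have h1 := h f (Finset.mem_union_left _ (Finset.mem_filter.2 ⟨hf, hfv.le⟩))
          linarith
        · obtain ⟨f₁, hf₁, rfl⟩ := Finset.mem_image.1 htT
          have hn := (Finset.mem_filter.1 hf₁).2
          have h1 := h _ (Finset.mem_union_right _ (Finset.mem_image.2 ⟨(f₁, f),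
            Finset.mem_product.2 ⟨hf₁, Finset.mem_filter.2 ⟨hf, hfv⟩⟩, rfl⟩))
          simp only [LinearMap.sub_apply, LinearMap.smul_apply, smul_eq_mul] at h1
          have h2 : f₁ x / f₁ v * f v ≤ f x := by
            rw [div_mul_eq_mul_div, div_le_iff_of_neg hn]
            linarith
          linarith

/-- A ray from a point of a finitely generated cone, in a direction outside of the cone, has a last
point in the cone. -/
lemma exists_last_mem_nonnegCombos {A : Finset (Fin m → ℤ)} {p y : Fin m → ℚ}
    (hp : p ∈ nonnegCombos A) (hy : y ∉ nonnegCombos A) :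
    ∃ t₀ : ℚ, p + t₀ • y ∈ nonnegCombos A ∧ ∀ t, t₀ < t → p + t • y ∉ nonnegCombos A := by
  classical
  obtain ⟨H, hH⟩ := exists_halfspaces_eq_nonnegCombos A
  rw [hH] at hp hy
  push Not at hy
  obtain ⟨h₀, hh₀, hh₀y⟩ := hy
  obtain ⟨f, hf, hmin⟩ := Finset.exists_min_image (H.filter fun h => h y < 0)
    (fun h => h p / -h y) ⟨h₀, Finset.mem_filter.2 ⟨hh₀, hh₀y⟩⟩
  obtain ⟨hfH, hfy⟩ := Finset.mem_filter.1 hf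
  have hfy' : 0 < -f y := by linarith
  have ht₀ : 0 ≤ f p / -f y := div_nonneg (hp f hfH) hfy'.le
  refine ⟨f p / -f y, ?_, fun t ht => ?_⟩
  · rw [hH]
    intro h hh
    rw [map_add, map_smul, smul_eq_mul]
    rcases lt_or_ge (h y) 0 with hhy | hhy
    · have h1 := hmin h (Finset.mem_filter.2 ⟨hh, hhy⟩)
      rw [le_div_iff₀ (by linarith)] at h1
      linarith
    · exact add_nonneg (hp h hh) (mul_nonneg ht₀ hhy)
  · rw [hH]
    push Not
    refine ⟨f, hfH, ?_⟩
    rw [div_lt_iff₀ hfy'] at ht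
    rw [map_add, map_smul, smul_eq_mul]
    linarith

lemma exists_nsmul_eq_of_mem_nonnegCombos {A : Finset (Fin m → ℤ)} {x : Fin m → ℚ}
    (hx : x ∈ nonnegCombos A) :
    ∃ N : ℕ, 0 < N ∧ ∃ w ∈ AddSubmonoid.closure (A : Set (Fin m → ℤ)),
      toRat w = (N : ℚ) • x := by
  obtain ⟨q, hq, rfl⟩ := hx
  obtain ⟨N, hN, z, hz⟩ := exists_nat_mul_eq_intCast_of_mem A q
  refine ⟨N, hN, _, sum_nsmul_mem_closure A fun a => (z a).toNat, ?_⟩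
  rw [toRat_sum, Finset.smul_sum]
  refine Finset.sum_congr rfl fun a ha => ?_
  have h1 : (0 : ℚ) ≤ z a := by
    rw [← hz a ha]
    exact mul_nonneg (Nat.cast_nonneg _) (hq a ha)
  have h2 : 0 ≤ z a := by exact_mod_cast h1
  rw [← natCast_zsmul, Int.toNat_of_nonneg h2, toRat_zsmul, smul_smul, hz a ha]

lemma nonnegCombos_subset_cone (A : Finset (Fin m → ℤ)) :
    nonnegCombos A ⊆ cone (AddSubmonoid.closure (A : Set (Fin m → ℤ))) := by
  intro x hx
  obtain ⟨N, hN, w, hw, h⟩ := exists_nsmul_eq_of_mem_nonnegCombos hx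
  have hN0 : (N : ℚ) ≠ 0 := by positivity
  refine ⟨(N : ℚ)⁻¹, by positivity, w, hw, ?_⟩
  rw [h, smul_smul, inv_mul_cancel₀ hN0, one_smul]

/-- If `f' - f` were outside of the cone, the ray from the sum of the generators in this direction
would leave the cone at a point `z`. A suitable multiple `w` of `z` lies in the semigroup but not
in the relative interior, whereas `f - f' + w` does lie there, whence `f + w = f' + (f - f' + w)`
would belong to the semigroup. -/
theorem IsIteratedGluing.sub_mem_nonnegCombos {A : Finset (Fin m → ℤ)} {D : Multiset (Fin m → ℤ)}
    (h : IsIteratedGluing A D) {f' : Fin m → ℤ}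
    (hf' : f' ∈ AddSubgroup.closure (A : Set (Fin m → ℤ)))
    (hadd : ∀ g ∈ AddSubgroup.closure (A : Set (Fin m → ℤ)), toRat g ∈ posCombos A →
      f' + g ∈ AddSubmonoid.closure (A : Set (Fin m → ℤ))) :
    toRat (f' - gluingVector A D) ∈ nonnegCombos A := by
  by_contra hy
  set f := gluingVector A D
  have hfG : f ∈ AddSubgroup.closure (A : Set (Fin m → ℤ)) := h.gluingVector_mem
  obtain ⟨c, hc⟩ := exists_int_combination (sub_mem hf' hfG)
  have hyc : toRat (f' - f) = ∑ a ∈ A, (c a : ℚ) • toRat a := by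
    rw [hc, toRat_sum]
    exact Finset.sum_congr rfl fun a _ => toRat_zsmul _ _
  set y := toRat (f' - f)
  let p : Fin m → ℚ := ∑ a ∈ A, (1 : ℚ) • toRat a
  have hp : p ∈ posCombos A := ⟨fun _ => 1, fun _ _ => one_pos, rfl⟩
  obtain ⟨t₀, hz, hlast⟩ := exists_last_mem_nonnegCombos (posCombos_subset_nonnegCombos hp) hy
  have hmove : ∀ x ∈ posCombos A, ∃ ε : ℚ, 0 < ε ∧ x + ε • y ∈ nonnegCombos A := by
    intro x hx
    obtain ⟨ε, hε, h'⟩ := exists_add_smul_mem_posCombos hx (fun a => (c a : ℚ))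
    rw [← hyc] at h'
    exact ⟨ε, hε, posCombos_subset_nonnegCombos (h' ε hε.le le_rfl)⟩
  have ht₀ : 0 < t₀ := by
    obtain ⟨ε, hε, h'⟩ := hmove p hp
    by_contra! h''
    exact hlast ε (by linarith) h'
  have hzpos : p + t₀ • y ∉ posCombos A := by
    intro h'
    obtain ⟨ε, hε, h'⟩ := hmove _ h'
    rw [add_assoc, ← add_smul] at h'
    exact hlast (t₀ + ε) (by linarith) h'
  obtain ⟨N, hN, w, hw, hwz⟩ := exists_nsmul_eq_of_mem_nonnegCombos
    (smul_mem_nonnegCombos (inv_nonneg.2 ht₀.le) hz)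
  have hN1 : (1 : ℚ) ≤ N := by exact_mod_cast hN
  have hwpos : toRat w ∉ posCombos A := by
    intro h'
    apply hzpos
    have h1 := smul_mem_posCombos (c := t₀ * (N : ℚ)⁻¹) (by positivity) h'
    rwa [hwz, smul_smul, smul_smul, show t₀ * (N : ℚ)⁻¹ * (N : ℚ) * t₀⁻¹ = 1 by field_simp,
      one_smul] at h1
  apply hwpos
  apply h.mem_posCombos w hw
  have hg : toRat (f - f' + w) ∈ posCombos A := by
    have h1 : toRat (f - f' + w) = t₀⁻¹ • p + ((N - 1) * t₀⁻¹) • (p + t₀ • y) := by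
      have h2 : toRat (f - f') = -y := by
        simp only [y, toRat_sub]
        abel
      rw [toRat_add, h2, hwz]
      have h3 : (N : ℚ) • t₀⁻¹ • (p + t₀ • y) =
          t₀⁻¹ • p + (t₀⁻¹ * t₀) • y + (((N : ℚ) - 1) * t₀⁻¹) • (p + t₀ • y) := by module
      rw [h3, inv_mul_cancel₀ ht₀.ne', one_smul]
      abel
    rw [h1]
    exact add_mem_posCombos (smul_mem_posCombos (inv_pos.2 ht₀) hp)
      (smul_mem_nonnegCombos (mul_nonneg (by linarith) (inv_nonneg.2 ht₀.le)) hz)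
  have h1 := hadd (f - f' + w)
    (add_mem (sub_mem hfG hf') (AddSubgroup.le_closure_toAddSubmonoid _ hw)) hg
  rwa [show f' + (f - f' + w) = f + w by abel] at h1

lemma IsIteratedGluing.nonempty {A : Finset (Fin m → ℤ)} {D : Multiset (Fin m → ℤ)}
    (h : IsIteratedGluing A D) : A.Nonempty := by
  induction h with
  | free A hne hA => exact hne
  | glue A₁ A₂ D₁ D₂ d _ _ hd ih₁ ih₂ => exact ih₁.mono Finset.subset_union_left

lemma zero_notMem_posCombos {A : Finset (Fin m → ℤ)} (hne : A.Nonempty) (hA : ∀ a ∈ A, 0 < a) :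
    (0 : Fin m → ℚ) ∉ posCombos A := by
  rintro ⟨q, hq, h⟩
  obtain ⟨a, ha⟩ := hne
  obtain ⟨-, i, hi⟩ := Pi.lt_def.1 (hA a ha)
  have h1 := congrFun h i
  simp only [Finset.sum_apply, Pi.smul_apply, smul_eq_mul, Pi.zero_apply] at h1
  have h2 : 0 < ∑ b ∈ A, q b * toRat b i := by
    refine Finset.sum_pos' (fun b hb => mul_nonneg (hq b hb).le ?_)
      ⟨a, ha, mul_pos (hq a ha) ?_⟩
    · exact Int.cast_nonneg ((hA b hb).le i)
    · exact Int.cast_pos.2 hi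
  exact h2.ne h1

lemma relInteriorCone_eq_posCombos {S : AddSubmonoid (Fin m → ℤ)} (hS : ∀ s ∈ S, 0 ≤ s)
    {A : Finset (Fin m → ℤ)} (hA : IsMinimalGenerating S A) :
    relInteriorCone S = posCombos A := by
  ext x
  constructor
  · rintro ⟨B, hB, h⟩
    rw [hA.unique hS hB]
    exact h
  · exact fun h => ⟨A, hA, h⟩

end AffineSemigroup


theorem mainTheorem4 {m : ℕ} (S : AddSubmonoid (Fin m → ℤ)) (hS0 : S ≠ ⊥)
    (hS : AffineSemigroup.IsCompleteIntersection S)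
    (A : Finset (Fin m → ℤ)) (hA : AffineSemigroup.IsMinimalGenerating S A) :
    (∃ D : Multiset (Fin m → ℤ), AffineSemigroup.IsIteratedGluing A D) ∧
    ∀ D : Multiset (Fin m → ℤ), AffineSemigroup.IsIteratedGluing A D →
      AffineSemigroup.IsFrobeniusVector S (AffineSemigroup.gluingVector A D) ∧
      ∀ f' : Fin m → ℤ, AffineSemigroup.IsFrobeniusVector S f' →
        ∃ c ∈ AffineSemigroup.cone S,
          AffineSemigroup.toRat f' =
            AffineSemigroup.toRat (AffineSemigroup.gluingVector A D) + c := by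
  refine ⟨hS.exists_isIteratedGluing hS0 hA, fun D hD => ?_⟩
  have hnn : ∀ s ∈ S, 0 ≤ s := hS.1.2
  have hpos : ∀ a ∈ A, 0 < a := fun a ha => hA.pos hnn ha
  have hrel := AffineSemigroup.relInteriorCone_eq_posCombos hnn hA
  obtain rfl : AddSubmonoid.closure (A : Set (Fin m → ℤ)) = S := hA.prop
  simp only [AffineSemigroup.IsFrobeniusVector, AffineSemigroup.groupSpan_closure, hrel]
  refine ⟨⟨hD.gluingVector_mem, fun h => ?_, hD.gluingVector_add_mem⟩, ?_⟩
  · have h1 := hD.mem_posCombos 0 (zero_mem _) (by rwa [add_zero])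
    rw [AffineSemigroup.toRat_zero] at h1
    exact AffineSemigroup.zero_notMem_posCombos hD.nonempty hpos h1
  · rintro f' ⟨hf', -, hadd⟩
    refine ⟨_, AffineSemigroup.nonnegCombos_subset_cone A (hD.sub_mem_nonnegCombos hf' hadd), ?_⟩
    rw [AffineSemigroup.toRat_sub, add_sub_cancel]
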